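/- **Theorem 1.** For every integer $n>0$ there is a constant $C(n)>0$, depending only on $n$, with the following property. Let $\delta>0$ and let $(X,d)$ be a non-empty geodesic metric space that is $\delta$-hyperbolic, i.e. each side of every geodesic triangle in $X$ is contained in the $\delta$-neighborhood of the union of the other two sides. Let $G$ be a group generated by elements $g_1,\dots,g_n$ that acts on $X$ by isometries. Then at least one of the following holds: 1. $G$ is free on $(g_1,\dots,g_n)$, and for every $x\in X$ the orbit map $G\to X$, $h\mapsto hx$, is a quasi-isometric embedding, where $G$ carries the word metric of the free basis $g_1,\dots,g_n$. (A map $f:(Y,d_Y)\to (X,d)$ is a quasi-isometric embedding if there are $\lambda\ge 1$ and $\varepsilon\ge 0$ with $\lambda^{-1}d_Y(a,b)-\varepsilon\le d(f(a),f(b))\le \lambda d_Y(a,b)+\varepsilon$ for all $a,b\in Y$.) 2. The tuple $(g_1,\dots,g_n)$ is Nielsen-equivalent to a tuple $(f_1,\dots,f_n)$ such that $d(f_1y,y)<\delta\, C(n)$ for some $y\in X$. (Two $n$-tuples of elements of $G$ are Nielsen-equivalent if one is obtained from the other by a finite chain of moves of the following kinds: replace an entry $g_i$ by $g_i^{-1}$;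 for some $i\ne j$ replace $g_i$ by $g_ig_j$; for some $i\neq j$ interchange $g_i$ and $g_j$.) -/

import Mathlib

namespace NielsenHyp

section Metric

variable {X : Type*} [MetricSpace X]

/-- `S` is (the image of) a geodesic segment from `x` to `y`. -/
def IsGeodesicSegment (x y : X) (S : Set X) : Prop :=
  ∃ γ : ℝ → X, γ 0 = x ∧ γ (dist x y) = y ∧
    (∀ s ∈ Set.Icc 0 (dist x y), ∀ t ∈ Set.Icc 0 (dist x y), dist (γ s) (γ t) = |s - t|) ∧
    S = γ '' Set.Icc 0 (dist x y)

variable (X) in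
/-- Any two points are joined by a geodesic segment. -/
def IsGeodesicSpace : Prop :=
  ∀ x y : X, ∃ S : Set X, IsGeodesicSegment x y S

variable (X) in
/-- A `δ`-hyperbolic geodesic metric space: every side of every geodesic triangle lies in the
`δ`-neighbourhood of the union of the two other sides. -/
def IsHyperbolicGeodesicSpace (δ : ℝ) : Prop :=
  IsGeodesicSpace X ∧
    ∀ (x y z : X) (Sxy Sxz Syz : Set X),
      IsGeodesicSegment x y Sxy → IsGeodesicSegment x z Sxz → IsGeodesicSegment y z Syz →
        ∀ p ∈ Sxy, ∃ q ∈ Sxz ∪ Syz, dist p q ≤ δ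

/-- `f` is a quasi-isometric embedding of `Y`, with distance function `dY`, into `X`. -/
def IsQuasiIsometricEmbedding {Y : Type*} (dY : Y → Y → ℝ) (f : Y → X) : Prop :=
  ∃ L : ℝ, 1 ≤ L ∧ ∃ A : ℝ, 0 ≤ A ∧ ∀ a b : Y,
    L⁻¹ * dY a b - A ≤ dist (f a) (f b) ∧ dist (f a) (f b) ≤ L * dY a b + A

end Metric

section Group

variable {G : Type*} [Group G] {ι : Type*}

/-- One elementary Nielsen move on a tuple of group elements. -/
inductive NielsenMove [DecidableEq ι] : (ι → G) → (ι → G) → Prop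
  | inv (M : ι → G) (i : ι) : NielsenMove M (Function.update M i (M i)⁻¹)
  | mul (M : ι → G) (i j : ι) (hij : i ≠ j) : NielsenMove M (Function.update M i (M i * M j))
  | swap (M : ι → G) (i j : ι) (hij : i ≠ j) : NielsenMove M (M ∘ Equiv.swap i j)

/-- Nielsen equivalence: a finite chain of elementary Nielsen moves leads from `M` to `M'`. -/
def NielsenEquivalent [DecidableEq ι] (M M' : ι → G) : Prop :=
  Relation.ReflTransGen NielsenMove M M'

/-- `G` is free on the tuple `g`. -/
def IsFreeOn (g : ι → G) : Prop :=
  ∃ b : FreeGroupBasis ι G, ∀ i, b i = g i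

/-- The length of a shortest word in the letters `g i` and `(g i)⁻¹` that represents `h`
(for a generating tuple `g`). -/
noncomputable def wordLength (g : ι → G) (h : G) : ℕ :=
  sInf {k : ℕ | ∃ w : List (ι × Bool), FreeGroup.lift g (FreeGroup.mk w) = h ∧ w.length = k}

/-- The word metric on `G` with respect to a generating tuple `g`; if `G` is free on `g`,
this is the free group word metric. -/
noncomputable def wordDist (g : ι → G) (a b : G) : ℝ :=
  wordLength g (a⁻¹ * b)

end Group

end NielsenHyp

/-! A tuple Nielsen equivalent to $g$ is carried by a connected finite graph: a spanning tree with
trivial labels and one further labelled edge per entry. Placing the vertices in $X$ amounts to an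
equivariant map from the universal cover of the graph to $X$; an edge is measured from its start to
the translate, by its label, of its end. Folding, contracting tree edges and exchanging tree edges
stay inside the Nielsen class.

Take such a graph with total length within $\delta$ of the infimum and, for that length bound, with
as few vertices as possible. Unless there is only one vertex, all degrees are at least 3, since
otherwise `MarkedGraph.exists_contract` removes a vertex; so there are at most $3n$ edges. Hence
some gap in a fast growing sequence of scales contains no edge length (`exists_gap`), and every edge
is either short or very long. Exchanges (`MarkedGraph.exists_exchange`) bring short edges into the
tree as far as possible.

If a generator edge is still short, its ends are joined by short tree edges, so its label moves a
point by a bounded multiple of $\delta$. Otherwise the short edges form a forest, whose components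
are clusters of small diameter. Two long half-edges leaving a cluster and running together for a
while could be folded, saving more than $\delta$; so they diverge
(`MarkedGraph.NearMinimal.gprod_far_le`). Paths without backtracking are then broken geodesics with
long pieces and small Gromov products, and the four point condition gives progress at least $\delta$
per long edge (`MarkedGraph.Diverging.arrives_step`). Each letter of a reduced word crosses a long
edge, so displacement grows linearly in word length, which yields freeness and quasi-isometric
embeddings (`free_and_quasiIsometric`). -/

namespace NielsenHyp

/-! ### Gromov products and the four point condition -/

section Geometry

variable {X : Type*} [MetricSpace X]

/-- The Gromov product `(x | y)_w`. -/
noncomputable def gprod (w x y : X) : ℝ := (dist w x + dist w y - dist x y) / 2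

lemma gprod_comm (w x y : X) : gprod w x y = gprod w y x := by
  unfold gprod; rw [dist_comm x y]; ring

lemma gprod_le_left (w x y : X) : gprod w x y ≤ dist w x := by
  unfold gprod; linarith [dist_triangle w x y]

lemma gprod_le_add_dist (w w' x y : X) : gprod w x y ≤ gprod w' x y + dist w w' := by
  unfold gprod; linarith [dist_triangle w w' x, dist_triangle w w' y]

lemma gprod_le_dist_of_mem {x y : X} {S : Set X} (hS : IsGeodesicSegment x y S) {q : X}
    (hq : q ∈ S) (w : X) : gprod w x y ≤ dist w q := by
  obtain ⟨γ, h0, h1, hγ, rfl⟩ := hS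
  obtain ⟨t, ht, rfl⟩ := hq
  have e1 := hγ 0 ⟨le_rfl, dist_nonneg⟩ t ht
  have e2 := hγ t ht (dist x y) ⟨dist_nonneg, le_rfl⟩
  rw [h0, zero_sub, abs_neg, abs_of_nonneg ht.1] at e1
  rw [h1, abs_sub_comm, abs_of_nonneg (by linarith [ht.2])] at e2
  unfold gprod
  have t1 := dist_triangle w (γ t) x
  have t2 := dist_triangle w (γ t) y
  rw [dist_comm (γ t) x] at t1
  linarith

lemma IsGeodesicSegment.dist_add_dist {x y : X} {S : Set X} (hS : IsGeodesicSegment x y S)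
    {q : X} (hq : q ∈ S) : dist x q + dist q y = dist x y := by
  obtain ⟨γ, h0, h1, hγ, rfl⟩ := hS
  obtain ⟨t, ht, rfl⟩ := hq
  have e1 := hγ 0 ⟨le_rfl, dist_nonneg⟩ t ht
  have e2 := hγ t ht (dist x y) ⟨dist_nonneg, le_rfl⟩
  rw [h0, zero_sub, abs_neg, abs_of_nonneg ht.1] at e1
  rw [h1, abs_sub_comm, abs_of_nonneg (by linarith [ht.2])] at e2
  linarith

lemma IsGeodesicSegment.left_mem {x y : X} {S : Set X} (hS : IsGeodesicSegment x y S) :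
    x ∈ S := by
  obtain ⟨γ, h0, -, -, rfl⟩ := hS
  exact ⟨0, ⟨le_rfl, dist_nonneg⟩, h0⟩

lemma IsGeodesicSpace.exists_between (hX : IsGeodesicSpace X) (x y : X) {t : ℝ} (h0 : 0 ≤ t)
    (h1 : t ≤ dist x y) : ∃ w, dist x w = t ∧ dist w y = dist x y - t := by
  obtain ⟨S, hS⟩ := hX x y
  have hS' := hS
  obtain ⟨γ, g0, g1, hγ, rfl⟩ := hS
  have e1 := hγ 0 ⟨le_rfl, dist_nonneg⟩ t ⟨h0, h1⟩
  rw [g0, zero_sub, abs_neg, abs_of_nonneg h0] at e1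
  have := hS'.dist_add_dist ⟨t, ⟨h0, h1⟩, rfl⟩
  exact ⟨γ t, e1, by linarith⟩

/-- A geodesic comes close to the base point, up to the Gromov product. -/
lemma exists_mem_segment_dist_le {δ : ℝ} (hδ : 0 < δ) (hX : IsHyperbolicGeodesicSpace X δ)
    (w x y : X) {S : Set X} (hS : IsGeodesicSegment x y S) :
    ∃ p ∈ S, dist w p ≤ gprod w x y + 4 * δ := by
  obtain ⟨Sx, hx⟩ := hX.1 x w
  obtain ⟨Sy, hy⟩ := hX.1 y w
  have thin := hX.2 x y w S Sx Sy hS hx hy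
  have hS' := hS
  obtain ⟨γ, h0, h1, hγ, rfl⟩ := hS
  have hc : ContinuousOn γ (Set.Icc 0 (dist x y)) := by
    have : LipschitzOnWith 1 γ (Set.Icc 0 (dist x y)) :=
      LipschitzOnWith.of_dist_le_mul fun s hs t ht => by
        rw [hγ s hs t ht, Real.dist_eq]; simp
    exact this.continuousOn
  have c1 : ContinuousOn (fun t => Metric.infDist (γ t) Sx) (Set.Icc 0 (dist x y)) :=
    (Metric.continuous_infDist_pt Sx).comp_continuousOn hc
  have c2 : ContinuousOn (fun t => Metric.infDist (γ t) Sy) (Set.Icc 0 (dist x y)) :=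
    (Metric.continuous_infDist_pt Sy).comp_continuousOn hc
  -- The difference of the distances to the two other sides changes sign along the segment; where it
  -- vanishes, the point is close to both sides.
  have ivt := intermediate_value_Icc (dist_nonneg (x := x) (y := y)) (c1.sub c2)
  have hz : (0 : ℝ) ∈ Set.Icc (Metric.infDist (γ 0) Sx - Metric.infDist (γ 0) Sy)
      (Metric.infDist (γ (dist x y)) Sx - Metric.infDist (γ (dist x y)) Sy) := by
    rw [h0, h1, Metric.infDist_zero_of_mem hx.left_mem, Metric.infDist_zero_of_mem hy.left_mem]
    constructor
    · linarith [Metric.infDist_nonneg (x := x) (s := Sy)]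
    · linarith [Metric.infDist_nonneg (x := y) (s := Sx)]
  obtain ⟨t, ht, h⟩ := ivt hz
  have heq : Metric.infDist (γ t) Sx = Metric.infDist (γ t) Sy := sub_eq_zero.mp h
  have hle : Metric.infDist (γ t) Sx ≤ δ := by
    obtain ⟨q, hq | hq, hd⟩ := thin (γ t) ⟨t, ht, rfl⟩
    · exact (Metric.infDist_le_dist_of_mem hq).trans hd
    · rw [heq]; exact (Metric.infDist_le_dist_of_mem hq).trans hd
  -- Radius `2 * δ` avoids having to attain the infimum. Each of the two sides then bounds `dist w
  -- p` with error `4 * δ`, and averaging the bounds gives the Gromov product.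
  obtain ⟨q, hq, dq⟩ := (Metric.infDist_lt_iff ⟨x, hx.left_mem⟩).1
    (show Metric.infDist (γ t) Sx < 2 * δ by linarith)
  obtain ⟨r, hr, dr⟩ := (Metric.infDist_lt_iff ⟨y, hy.left_mem⟩).1
    (show Metric.infDist (γ t) Sy < 2 * δ by linarith)
  refine ⟨γ t, ⟨t, ht, rfl⟩, ?_⟩
  have e := hS'.dist_add_dist (q := γ t) ⟨t, ht, rfl⟩
  have e1 := hx.dist_add_dist hq
  have e2 := hy.dist_add_dist hr
  generalize γ t = p at *
  unfold gprod
  have a1 := dist_triangle x q p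
  have a2 := dist_triangle w q p
  have a3 := dist_triangle y r p
  have a4 := dist_triangle w r p
  rw [dist_comm q p] at a1 a2
  rw [dist_comm r p] at a3 a4
  rw [dist_comm q w] at e1
  rw [dist_comm r w] at e2
  rw [dist_comm p y] at e
  rw [dist_comm w x, dist_comm w y]
  linarith

/-- Gromov's four point condition. -/
lemma four_point {δ : ℝ} (hδ : 0 < δ) (hX : IsHyperbolicGeodesicSpace X δ) (w x y z : X) :
    min (gprod w x y) (gprod w y z) ≤ gprod w x z + 5 * δ := by
  obtain ⟨Sxz, h1⟩ := hX.1 x z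
  obtain ⟨Sxy, h2⟩ := hX.1 x y
  obtain ⟨Szy, h3⟩ := hX.1 z y
  obtain ⟨p, hp, dp⟩ := exists_mem_segment_dist_le hδ hX w x z h1
  -- The error is `4 * δ` for reaching `p` plus `δ` for passing to another side.
  obtain ⟨q, hq | hq, dq⟩ := hX.2 x z y Sxz Sxy Szy h1 h2 h3 p hp
  · have := gprod_le_dist_of_mem h2 hq w
    refine (min_le_left _ _).trans ?_
    linarith [dist_triangle w p q]
  · have := gprod_le_dist_of_mem h3 hq w
    rw [gprod_comm] at this
    refine (min_le_right _ _).trans ?_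
    linarith [dist_triangle w p q]

end Geometry

/-! ### Connectivity in finite graphs given by half-edges -/

section Connectivity

variable {V K : Type*}

/-- `x` and `y` are the two ends of an edge in `A`. -/
def EdgeAdj (o : K × Bool → V) (A : Set K) (x y : V) : Prop :=
  ∃ k ∈ A, ∃ b, o (k, b) = x ∧ o (k, !b) = y

/-- `x` and `y` are joined by a path of edges in `A`. -/
def Joined (o : K × Bool → V) (A : Set K) : V → V → Prop :=
  Relation.ReflTransGen (EdgeAdj o A)

variable {o : K × Bool → V} {A B : Set K} {x y z : V}

lemma Joined.refl (x : V) : Joined o A x x := Relation.ReflTransGen.refl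

lemma Joined.trans (h : Joined o A x y) (h' : Joined o A y z) : Joined o A x z :=
  Relation.ReflTransGen.trans h h'

lemma Joined.symm (h : Joined o A x y) : Joined o A y x := by
  induction h with
  | refl => exact Joined.refl _
  | tail _ h ih =>
    obtain ⟨k, hk, b, h1, h2⟩ := h
    exact Relation.ReflTransGen.head ⟨k, hk, !b, h2, by simpa using h1⟩ ih

lemma Joined.mono (hAB : A ⊆ B) (h : Joined o A x y) : Joined o B x y :=
  Relation.ReflTransGen.mono (fun _ _ ⟨k, hk, r⟩ => ⟨k, hAB hk, r⟩) _ _ h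

lemma joined_edge {k : K} (hk : k ∈ A) (b : Bool) : Joined o A (o (k, b)) (o (k, !b)) :=
  Relation.ReflTransGen.single ⟨k, hk, b, rfl, rfl⟩

/-- A map of vertex sets which sends edges to joined pairs preserves being joined. -/
lemma Joined.map {V' K' : Type*} {o' : K' × Bool → V'} {A' : Set K'} (r : V → V')
    (hr : ∀ k ∈ A, Joined o' A' (r (o (k, true))) (r (o (k, false)))) (h : Joined o A x y) :
    Joined o' A' (r x) (r y) := by
  induction h with
  | refl => exact Joined.refl _
  | tail _ h ih =>
    obtain ⟨k, hk, b, rfl, rfl⟩ := h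
    refine ih.trans ?_
    cases b
    · exact (hr k hk).symm
    · exact hr k hk

/-- A path can be shortened so as to cross `t` at most once. This is what later excludes
backtracking and drives the inductions over edge sets. -/
lemma Joined.of_insert {t : K} (h : Joined o (insert t A) x y) :
    Joined o A x y ∨ ∃ b, Joined o A x (o (t, b)) ∧ Joined o A (o (t, !b)) y := by
  induction h with
  | refl => exact Or.inl (Joined.refl _)
  | tail _ h ih =>
    obtain ⟨k, hk, b, rfl, rfl⟩ := h
    rcases hk with rfl | hk
    · rcases ih with ih | ⟨b', h1, h2⟩
      · exact Or.inr ⟨b, ih, Joined.refl _⟩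
      · by_cases hb : b = b'
        · subst hb
          exact Or.inr ⟨b, h1, Joined.refl _⟩
        · have : b' = !b := by cases b <;> cases b' <;> simp_all
          subst this
          exact Or.inl h1
    · have e := joined_edge (o := o) hk b
      rcases ih with ih | ⟨b', h1, h2⟩
      · exact Or.inl (ih.trans e)
      · exact Or.inr ⟨b', h1, h2.trans e⟩

lemma Joined.eq_of_empty (h : Joined o (∅ : Set K) x y) : x = y := by
  induction h with
  | refl => rfl
  | tail _ h _ => obtain ⟨k, hk, -⟩ := h; exact absurd hk (by simp)

/-- `A` has at least `|V| - |A|` components. -/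
lemma exists_separated [Fintype V] (A : Finset K) :
    ∃ R : Finset V, Fintype.card V ≤ R.card + A.card ∧
      ∀ x ∈ R, ∀ y ∈ R, Joined o (A : Set K) x y → x = y := by
  classical
  induction A using Finset.induction_on with
  | empty => exact ⟨Finset.univ, by simp, fun x _ y _ h => by
      simp only [Finset.coe_empty] at h; exact h.eq_of_empty⟩
  | insert t A ht ih =>
    obtain ⟨R, hc, hR⟩ := ih
    rw [Finset.card_insert_of_notMem ht, Finset.coe_insert]
    by_cases h : ∃ r ∈ R, Joined o (A : Set K) r (o (t, true))
    · obtain ⟨r, hr, hj⟩ := h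
      refine ⟨R.erase r, ?_, ?_⟩
      · have := Finset.card_erase_add_one hr
        omega
      · intro x hx y hy hxy
        have hx' := Finset.mem_erase.1 hx
        have hy' := Finset.mem_erase.1 hy
        rcases hxy.of_insert with h | ⟨b, h1, h2⟩
        · exact hR x hx'.2 y hy'.2 h
        · cases b
          · exact absurd (hR y hy'.2 r hr (h2.symm.trans hj.symm)) hy'.1
          · exact absurd (hR x hx'.2 r hr (h1.trans hj.symm)) hx'.1
    · push Not at h
      refine ⟨R, by omega, fun x hx y hy hxy => ?_⟩
      rcases hxy.of_insert with h' | ⟨b, h1, h2⟩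
      · exact hR x hx y hy h'
      · cases b
        · exact absurd h2.symm (h y hy)
        · exact absurd h1 (h x hx)

lemma card_le_of_joined [Fintype V] (A : Finset K)
    (h : ∀ x y, Joined o (A : Set K) x y) : Fintype.card V ≤ A.card + 1 := by
  obtain ⟨R, hc, hR⟩ := exists_separated (o := o) A
  have : R.card ≤ 1 := Finset.card_le_one.2 fun x hx y hy => hR x hx y hy (h x y)
  omega

/-- A joined pair which is not joined in the subset `B` needs an edge outside `B`. -/
lemma Joined.exists_essential (A : Finset K) (h : Joined o (A : Set K) x y)
    (hB : ¬ Joined o B x y) :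
    ∃ t ∉ B, ∃ b,
      Joined o {t}ᶜ x (o (t, b)) ∧ Joined o {t}ᶜ (o (t, !b)) y := by
  classical
  induction A using Finset.strongInduction with
  | H A ih =>
    -- Shrink `A` until no edge can be dropped. Some edge of the remaining set lies outside `B`, and
    -- the path must cross it.
    by_cases hA : ∃ t ∈ A, Joined o ((A.erase t : Finset K) : Set K) x y
    · obtain ⟨t, ht, hj⟩ := hA
      exact ih _ (Finset.erase_ssubset ht) hj
    · push Not at hA
      obtain ⟨t, ht, htB⟩ : ∃ t ∈ (A : Set K), t ∉ B := by
        by_contra! hc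
        exact hB (h.mono hc)
      have hsub : ((A.erase t : Finset K) : Set K) ⊆ {t}ᶜ := by
        intro k hk
        simp only [Finset.coe_erase] at hk
        exact hk.2
      have h' := h
      rw [← Finset.insert_erase (Finset.mem_coe.1 ht), Finset.coe_insert] at h'
      obtain h' | ⟨b, h1, h2⟩ := h'.of_insert
      · exact absurd h' (hA t ht)
      · exact ⟨t, htB, b, h1.mono hsub, h2.mono hsub⟩

/-- Adding an edge turns a bound `d` into `2 * d + s`, by `Joined.of_insert`; hence the exponential
constant, crude but sufficient. -/
lemma Joined.dist_le {X : Type*} [MetricSpace X] (p : V → X) {s : ℝ} (hs : 0 ≤ s) (A : Finset K)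
    (hA : ∀ k ∈ A, dist (p (o (k, true))) (p (o (k, false))) ≤ s)
    (h : Joined o (A : Set K) x y) : dist (p x) (p y) ≤ (2 ^ A.card - 1) * s := by
  classical
  induction A using Finset.induction_on generalizing x y with
  | empty =>
    rw [Finset.coe_empty] at h
    simp [h.eq_of_empty]
  | insert t A ht ih =>
    rw [Finset.coe_insert] at h
    rw [Finset.card_insert_of_notMem ht, pow_succ]
    have ih' := fun {x y} => ih (x := x) (y := y) (fun k hk => hA k (Finset.mem_insert_of_mem hk))
    have h2 : (1 : ℝ) ≤ 2 ^ A.card := one_le_pow₀ (by norm_num)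
    rcases h.of_insert with h | ⟨b, h1, h3⟩
    · have := ih' h
      nlinarith
    · have e1 := ih' h1
      have e2 := ih' h3
      have e3 : dist (p (o (t, b))) (p (o (t, !b))) ≤ s := by
        have := hA t (Finset.mem_insert_self _ _)
        cases b
        · rw [dist_comm]; exact this
        · exact this
      have := dist_triangle4 (p x) (p (o (t, b))) (p (o (t, !b))) (p y)
      linarith

end Connectivity


/-! ### Composite Nielsen moves -/

section Nielsen

variable {G : Type*} [Group G] {ι : Type*} [DecidableEq ι]

lemma NielsenEquivalent.trans {f g h : ι → G} (h1 : NielsenEquivalent f g)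
    (h2 : NielsenEquivalent g h) : NielsenEquivalent f h :=
  Relation.ReflTransGen.trans h1 h2

lemma NielsenEquivalent.inv (f : ι → G) (i : ι) :
    NielsenEquivalent f (Function.update f i (f i)⁻¹) :=
  Relation.ReflTransGen.single (.inv f i)

lemma NielsenEquivalent.mul_right (f : ι → G) {i j : ι} (hij : j ≠ i) :
    NielsenEquivalent f (Function.update f j (f j * f i)) :=
  Relation.ReflTransGen.single (.mul f j i hij)

lemma NielsenEquivalent.mul_inv_right (f : ι → G) {i j : ι} (hij : j ≠ i) :
    NielsenEquivalent f (Function.update f j (f j * (f i)⁻¹)) := by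
  have h1 := NielsenEquivalent.inv f i
  have h2 := h1.trans (NielsenEquivalent.mul_right _ hij)
  have h3 := h2.trans (NielsenEquivalent.inv _ i)
  convert h3 using 1
  funext k
  by_cases hk : k = i
  · subst hk; simp [Function.update_of_ne hij.symm]
  · by_cases hk' : k = j
    · subst hk'; simp [hij]
    · simp [hk, hk']

lemma NielsenEquivalent.mul_left (f : ι → G) {i j : ι} (hij : j ≠ i) :
    NielsenEquivalent f (Function.update f j (f i * f j)) := by
  have h1 := NielsenEquivalent.inv f j
  have h2 := h1.trans (NielsenEquivalent.mul_inv_right _ hij)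
  have h3 := h2.trans (NielsenEquivalent.inv _ j)
  convert h3 using 1
  funext k
  by_cases hk' : k = j
  · subst hk'; simp [Function.update_of_ne hij.symm]
  · simp [hk']

/-- Multiplying all entries but the `i`-th by suitable elements of `{1, f i}` on the left and by
inverses of such elements on the right, and possibly inverting the `i`-th one. -/
lemma NielsenEquivalent.twist [Fintype ι] (f f' : ι → G) (i : ι)
    (hi : f' i = f i ∨ f' i = (f i)⁻¹) (a b : ι → G) (ha : ∀ j, a j = 1 ∨ a j = f i)
    (hb : ∀ j, b j = 1 ∨ b j = f i) (hf : ∀ j ≠ i, f' j = a j * f j * (b j)⁻¹) :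
    NielsenEquivalent f f' := by
  -- Entries are changed one at a time. Entry `i` stays equal to `f i` until the end, because it
  -- supplies all factors; only then is it possibly inverted.
  have key : ∀ s : Finset ι, i ∉ s → NielsenEquivalent f (fun j => if j ∈ s then f' j else f j) := by
    intro s
    induction s using Finset.induction_on with
    | empty => intro _; simp only [Finset.notMem_empty, if_false]; exact Relation.ReflTransGen.refl
    | insert t s ht ih =>
      intro hi'
      have hit : t ≠ i := fun h => hi' (by simp [h])
      have his : i ∉ s := fun h => hi' (by simp [h])
      have h1 := ih his
      set f1 : ι → G := fun j => if j ∈ s then f' j else f j with hf1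
      have e1 : f1 i = f i := by simp [hf1, his]
      have e2 : f1 t = f t := by simp [hf1, ht]
      obtain ⟨f2, h2, e3⟩ : ∃ f2, NielsenEquivalent f1 f2 ∧
          f2 = Function.update f1 t (a t * f t) := by
        rcases ha t with h | h
        · exact ⟨f1, Relation.ReflTransGen.refl, by rw [h, one_mul, ← e2, Function.update_eq_self]⟩
        · refine ⟨_, NielsenEquivalent.mul_left f1 hit, by rw [h, e1, e2]⟩
      obtain ⟨f3, h3, e4⟩ : ∃ f3, NielsenEquivalent f2 f3 ∧
          f3 = Function.update f1 t (a t * f t * (b t)⁻¹) := by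
        rcases hb t with h | h
        · exact ⟨f2, Relation.ReflTransGen.refl, by rw [h, inv_one, mul_one, e3]⟩
        · refine ⟨_, NielsenEquivalent.mul_inv_right f2 hit, ?_⟩
          rw [h, e3, Function.update_idem]
          simp [hit.symm, e1]
      refine (h1.trans (h2.trans h3)).trans ?_
      have : f3 = fun j => if j ∈ insert t s then f' j else f j := by
        rw [e4, ← hf t hit]
        funext j
        by_cases hj : j = t
        · subst hj; simp
        · simp [hj, hf1]
      rw [this]
      exact Relation.ReflTransGen.refl
  have h1 := key (Finset.univ.erase i) (by simp)
  rcases hi with hi | hi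
  · convert h1 using 1
    funext j
    by_cases hj : j = i
    · subst hj; simp [hi]
    · simp [hj]
  · convert h1.trans (NielsenEquivalent.inv _ i) using 1
    funext j
    by_cases hj : j = i
    · subst hj; simp [hi]
    · simp [hj]

end Nielsen

/-! ### Half-edges and lengths -/

section Length

variable {G : Type*} [Group G] {X : Type*} [MetricSpace X] [MulAction G X] {E : Type*}

/-- The opposite half-edge. -/
def rev (h : E × Bool) : E × Bool := (h.1, !h.2)

@[simp] lemma rev_rev (h : E × Bool) : rev (rev h) = h := by simp [rev]

@[simp] lemma rev_fst (h : E × Bool) : (rev h).1 = h.1 := rfl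

lemma rev_ne (h : E × Bool) : rev h ≠ h := by
  rcases h with ⟨e, b⟩
  cases b <;> simp [rev]

/-- The label of a half-edge. -/
def halfLabel (lab : E → G) (h : E × Bool) : G := cond h.2 (lab h.1) (lab h.1)⁻¹

lemma halfLabel_rev (lab : E → G) (h : E × Bool) :
    halfLabel lab (rev h) = (halfLabel lab h)⁻¹ := by
  rcases h with ⟨e, b⟩
  cases b <;> simp [rev, halfLabel]

/-- The far end of a half-edge whose edges start at the points given by `u`. -/
def tip (lab : E → G) (u : E × Bool → X) (h : E × Bool) : X := halfLabel lab h • u (rev h)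

/-- The length of an edge. -/
noncomputable def edgeLength (lab : E → G) (u : E × Bool → X) (e : E) : ℝ :=
  dist (u (e, true)) (lab e • u (e, false))

/-- The sum of all edge lengths. -/
noncomputable def totalLength [Fintype E] (lab : E → G) (u : E × Bool → X) : ℝ :=
  ∑ e, edgeLength lab u e

lemma dist_tip [IsIsometricSMul G X] (lab : E → G) (u : E × Bool → X) (h : E × Bool) :
    dist (u h) (tip lab u h) = edgeLength lab u h.1 := by
  rcases h with ⟨e, b⟩
  cases b
  · simp only [tip, halfLabel, rev, edgeLength, cond_false, Bool.not_false]
    rw [dist_comm, ← dist_smul (lab e), smul_inv_smul]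
  · rfl

variable [DecidableEq E]

omit [MetricSpace X] in
lemma tip_update (lab : E → G) (u : E × Bool → X) (h : E × Bool) (w : X) :
    tip lab (Function.update u h w) h = tip lab u h := by
  simp [tip, rev_ne]

/-- Moving the start of one half-edge leaves its own far end in place, as that is determined by the
opposite half-edge, and affects no other edge. -/
lemma totalLength_update [Fintype E] [IsIsometricSMul G X] (lab : E → G) (u : E × Bool → X)
    (h : E × Bool) (w : X) : totalLength lab (Function.update u h w) =
      totalLength lab u - dist (u h) (tip lab u h) + dist w (tip lab u h) := by
  have h1 : dist w (tip lab u h) = edgeLength lab (Function.update u h w) h.1 := by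
    rw [← dist_tip, tip_update, Function.update_self]
  rw [h1, dist_tip]
  unfold totalLength
  rw [← Finset.add_sum_erase _ _ (Finset.mem_univ h.1),
    ← Finset.add_sum_erase Finset.univ (edgeLength lab u) (Finset.mem_univ h.1)]
  have : ∑ e ∈ Finset.univ.erase h.1, edgeLength lab (Function.update u h w) e =
      ∑ e ∈ Finset.univ.erase h.1, edgeLength lab u e := by
    refine Finset.sum_congr rfl fun e he => ?_
    have he' : e ≠ h.1 := (Finset.mem_erase.1 he).1
    unfold edgeLength
    rw [Function.update_of_ne, Function.update_of_ne] <;>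
    · rintro rfl; exact he' rfl
  rw [this]; ring

end Length

/-! ### Marked graphs: folding, contraction, exchange -/

/-- A finite graph with vertices `V` and edges `K ⊕ ι`, mapped to `X` by a choice of points for
the vertices and of group elements for the edges. The edges in `K` form a spanning tree and have
trivial label, those in `ι` are labelled by a tuple which is Nielsen equivalent to `g`. -/
structure MarkedGraph {G : Type*} [Group G] {ι : Type*} [DecidableEq ι] (g : ι → G)
    (X : Type*) (V K : Type) [Fintype V] [Fintype K] where
  /-- the vertex at which a half-edge starts -/
  org : (K ⊕ ι) × Bool → V
  /-- the labels of the edges outside the tree -/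
  gen : ι → G
  /-- the positions of the vertices -/
  pos : V → X
  nielsen : NielsenEquivalent g gen
  conn : ∀ x y, Joined (fun h : K × Bool => org (.inl h.1, h.2)) Set.univ x y
  card : Fintype.card V = Fintype.card K + 1

namespace MarkedGraph

variable {G : Type*} [Group G] {ι : Type*} [DecidableEq ι] {g : ι → G}
  {X : Type*} [MetricSpace X] [MulAction G X] {V K : Type} [Fintype V] [Fintype K]

section

variable (S : MarkedGraph g X V K)

/-- The half-edges of the tree. -/
abbrev treeOrg : K × Bool → V := fun h => S.org (.inl h.1, h.2)

/-- The edge labels. -/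
def lab : K ⊕ ι → G := Sum.elim (fun _ => 1) S.gen

/-- The starting points of the half-edges. -/
def start (h : (K ⊕ ι) × Bool) : X := S.pos (S.org h)

/-- The sum of all edge lengths. -/
noncomputable def cost [Fintype ι] : ℝ := totalLength S.lab S.start

/-- The length of an edge. -/
noncomputable def len (e : K ⊕ ι) : ℝ := edgeLength S.lab S.start e

/-- The far end of a half-edge. -/
def far (h : (K ⊕ ι) × Bool) : X := tip S.lab S.start h

lemma cost_nonneg [Fintype ι] : 0 ≤ S.cost := Finset.sum_nonneg fun _ _ => dist_nonneg

end

variable [DecidableEq K]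

/-- The half-edges of a folded graph: `h` and `h'` start at the new vertex. -/
def foldOrg (org : (K ⊕ ι) × Bool → V) (h h' : (K ⊕ ι) × Bool) :
    (Option K ⊕ ι) × Bool → Option V
  | (.inl none, true) => some (org h)
  | (.inl none, false) => none
  | (.inl (some k), b) => if (.inl k, b) = h ∨ (.inl k, b) = h' then none else some (org (.inl k, b))
  | (.inr i, b) => if (.inr i, b) = h ∨ (.inr i, b) = h' then none else some (org (.inr i, b))

/-- The new vertex at `w` takes over the starts of `h` and `h'` and is tied to the old start of `h`
by a new tree edge. Since the tree path `A` between the old starts avoids both edges and has trivial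
labels, the tree stays connected and the generators need not change. -/
lemma exists_fold [Fintype ι] (S : MarkedGraph g X V K) (h h' : (K ⊕ ι) × Bool) (w : X)
    (A : Set K) (hA : ∀ k ∈ A, Sum.inl k ≠ h.1 ∧ Sum.inl k ≠ h'.1)
    (hj : Joined S.treeOrg A (S.org h) (S.org h')) :
    ∃ S' : MarkedGraph g X (Option V) (Option K), S'.cost = dist (S.start h) w +
      totalLength S.lab (Function.update (Function.update S.start h w) h' w) := by
  set o' : Option K × Bool → Option V := fun x => foldOrg S.org h h' (.inl x.1, x.2) with ho'
  have hh : Joined o' Set.univ (some (S.org h)) none :=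
    joined_edge (o := o') (Set.mem_univ none) true
  have hsome : ∀ k b, o' (some k, b) =
      if (Sum.inl k, b) = h ∨ (Sum.inl k, b) = h' then none else some (S.org (.inl k, b)) :=
    fun _ _ => rfl
  have hhh : Joined o' Set.univ (some (S.org h)) (some (S.org h')) := by
    refine hj.map some fun k hk => ?_
    have := joined_edge (o := o') (Set.mem_univ (some k)) true
    rw [Bool.not_true, hsome, hsome, if_neg, if_neg] at this
    · exact this
    all_goals
      rintro (rfl | rfl)
      · exact (hA k hk).1 rfl
      · exact (hA k hk).2 rfl
  have hatt : ∀ k b, Joined o' Set.univ (o' (some k, b)) (some (S.org (.inl k, b))) := by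
    intro k b
    rw [hsome]
    split_ifs with hc
    · rcases hc with hc | hc
      · rw [hc]; exact hh.symm
      · rw [hc]; exact hh.symm.trans hhh
    · exact Joined.refl _
  have hbase : ∀ x, Joined o' Set.univ x (some (S.org h)) := by
    rintro (_ | x)
    · exact hh.symm
    · refine (S.conn x (S.org h)).map some fun k _ => ?_
      exact ((hatt k true).symm.trans (joined_edge (o := o') (Set.mem_univ (some k)) true)).trans
        (hatt k false)
  refine ⟨⟨foldOrg S.org h h', S.gen, fun x => x.elim w S.pos, S.nielsen,
    fun x y => (hbase x).trans (hbase y).symm, by simp [S.card]⟩, ?_⟩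
  have key : ∀ x : (K ⊕ ι) × Bool, Function.update (Function.update S.start h w) h' w x =
      (if x = h ∨ x = h' then none else some (S.org x) : Option V).elim w S.pos := by
    intro x
    by_cases h1 : x = h'
    · subst h1; simp
    · by_cases h2 : x = h
      · subst h2; simp [h1]
      · simp [h1, h2, start]
  unfold cost totalLength
  rw [Fintype.sum_sum_type, Fintype.sum_sum_type, Fintype.sum_option, add_assoc]
  congr 1
  · simp [edgeLength, lab, start, foldOrg]
  congr 1
  · refine Finset.sum_congr rfl fun k _ => ?_
    unfold edgeLength
    rw [key, key]
    simp only [lab, start, foldOrg, Sum.elim_inl]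
  · refine Finset.sum_congr rfl fun k _ => ?_
    unfold edgeLength
    rw [key, key]
    simp only [lab, start, foldOrg, Sum.elim_inr]

/-- At a vertex of degree at most 2, slide the vertex along `k` to its other end: `k` shrinks to
length zero, and the only other half-edge `h` grows by at most the length of `k`. -/
lemma exists_contract [Fintype ι] [DecidableEq V] [IsIsometricSMul G X] (S : MarkedGraph g X V K)
    (k : K) (b : Bool) (hk : S.org (.inl k, !b) ≠ S.org (.inl k, b)) (h : (K ⊕ ι) × Bool)
    (hdeg : ∀ h', S.org h' = S.org (.inl k, b) → h' = (.inl k, b) ∨ h' = h) :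
    ∃ S' : MarkedGraph g X {x // x ≠ S.org (.inl k, b)} {j // j ≠ k}, S'.cost ≤ S.cost := by
  set v := S.org (.inl k, b) with hv
  set u := S.org (.inl k, !b) with hu
  set r : V → {x // x ≠ v} := fun x => if hx : x = v then ⟨u, hk⟩ else ⟨x, hx⟩ with hr
  have rv : r v = ⟨u, hk⟩ := by simp [hr]
  have rne : ∀ x (hx : x ≠ v), r x = ⟨x, hx⟩ := fun x hx => by simp [hr, hx]
  set o' : {j // j ≠ k} × Bool → {x // x ≠ v} := fun x => r (S.org (.inl x.1.1, x.2)) with ho'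
  have hconn : ∀ x y : {x // x ≠ v}, Joined o' Set.univ x y := by
    rintro ⟨x, hx⟩ ⟨y, hy⟩
    rw [← rne x hx, ← rne y hy]
    refine (S.conn x y).map r fun j _ => ?_
    by_cases hj : j = k
    · subst hj
      have : r (S.org (.inl j, b)) = r (S.org (.inl j, !b)) := by rw [← hv, ← hu, rv, rne u hk]
      cases b
      · simp only [Bool.not_false] at this
        simp only [this]; exact Joined.refl _
      · simp only [Bool.not_true] at this
        simp only [this]; exact Joined.refl _
    · exact joined_edge (o := o') (Set.mem_univ (⟨j, hj⟩ : {j // j ≠ k})) true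
  have hcard : Fintype.card {x // x ≠ v} = Fintype.card {j // j ≠ k} + 1 := by
    have h1 := Fintype.card_subtype_compl (fun x : V => x = v)
    have h2 := Fintype.card_subtype_compl (fun x : K => x = k)
    simp only [Fintype.card_subtype_eq] at h1 h2
    have := S.card
    have : 0 < Fintype.card K := Fintype.card_pos_iff.2 ⟨k⟩
    simp only [ne_eq]
    omega
  refine ⟨⟨fun x => r (S.org (x.1.map Subtype.val id, x.2)), S.gen, fun x => S.pos x.1, S.nielsen,
    hconn, hcard⟩, ?_⟩
  set u2 : (K ⊕ ι) × Bool → X := fun x => S.pos (r (S.org x)).1 with hu2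
  have hcost : totalLength S.lab u2 ≤ S.cost := by
    have hu2' : u2 = Function.update (Function.update S.start (.inl k, b) (S.pos u)) h
        (if S.org h = v then S.pos u else S.start h) := by
      funext x
      by_cases h1 : x = h
      · subst h1
        by_cases h2 : S.org x = v
        · simp [hu2, h2, rv]
        · simp [hu2, h2, rne, start]
      · by_cases h2 : x = (.inl k, b)
        · subst h2; simp [hu2, h1, ← hv, rv]
        · rw [Function.update_of_ne h1, Function.update_of_ne h2]
          have : S.org x ≠ v := fun h3 => by
            rcases hdeg x h3 with h4 | h4
            · exact h2 h4
            · exact h1 h4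
          simp [hu2, rne _ this, start]
    have t1 : tip S.lab S.start (.inl k, b) = S.pos u := by
      unfold tip halfLabel lab start
      cases b <;> simp [rev, hu]
    have c1 : totalLength S.lab (Function.update S.start (.inl k, b) (S.pos u)) =
        S.cost - dist (S.pos v) (S.pos u) := by
      rw [totalLength_update, t1, dist_self, add_zero]; rfl
    rw [hu2']
    split_ifs with hc
    · by_cases hhk : h = (.inl k, b)
      · rw [hhk, Function.update_idem, c1]
        linarith [dist_nonneg (x := S.pos v) (y := S.pos u)]
      · rw [totalLength_update, c1, Function.update_of_ne hhk]
        have : S.start h = S.pos v := by rw [start, hc]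
        rw [this]
        have := dist_triangle (S.pos u) (S.pos v)
          (tip S.lab (Function.update S.start (.inl k, b) (S.pos u)) h)
        rw [dist_comm (S.pos u) (S.pos v)] at this
        linarith
    · have : h ≠ (.inl k, b) := fun e => hc (by rw [e])
      rw [← Function.update_of_ne this (S.pos u) S.start, Function.update_eq_self, c1]
      linarith [dist_nonneg (x := S.pos v) (y := S.pos u)]
  refine le_trans ?_ hcost
  unfold cost totalLength
  rw [Fintype.sum_sum_type, Fintype.sum_sum_type]
  refine add_le_add ?_ (le_of_eq ?_)
  · calc _ = ∑ j : {j // j ≠ k}, edgeLength S.lab u2 (.inl j.1) := rfl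
      _ = ∑ j ∈ Finset.univ.erase k, edgeLength S.lab u2 (.inl j) := by
        rw [← Finset.sum_subtype (Finset.univ.erase k) (by simp)
          (fun j => edgeLength S.lab u2 (.inl j))]
      _ ≤ _ := Finset.sum_le_univ_sum_of_nonneg fun _ => dist_nonneg
  · rfl

omit [DecidableEq K] [MetricSpace X] [MulAction G X] in
lemma not_forall_joined_compl (S : MarkedGraph g X V K) (t : K) :
    ¬ ∀ x y, Joined S.treeOrg {t}ᶜ x y := by
  classical
  intro h
  have h1 := card_le_of_joined (o := S.treeOrg) (Finset.univ.erase t) (by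
    simpa [← Set.compl_eq_univ_sdiff] using h)
  rw [Finset.card_erase_of_mem (Finset.mem_univ _), Finset.card_univ, S.card] at h1
  have : 0 < Fintype.card K := Fintype.card_pos_iff.2 ⟨t⟩
  omega

/-- Removing `t` cuts the tree into two sides, which the edge `i` reconnects. Translating the
vertices on the far side by `S.gen i` trivializes the label of `i`, gives `t` the label `S.gen i` or
its inverse, and multiplies the other labels as in `NielsenEquivalent.twist`. Changing lifts of
vertices is isometric, so lengths are only permuted. -/
lemma exists_exchange [Fintype ι] [IsIsometricSMul G X] (S : MarkedGraph g X V K) (i : ι) (t : K)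
    (b : Bool) (h1 : Joined S.treeOrg {t}ᶜ (S.org (.inr i, true)) (S.org (.inl t, b)))
    (h2 : Joined S.treeOrg {t}ᶜ (S.org (.inl t, !b)) (S.org (.inr i, false))) :
    ∃ S' : MarkedGraph g X V K, ∀ e, S'.len (Equiv.swap (.inl t) (.inr i) e) = S.len e := by
  classical
  set u := S.org (.inr i, true) with hu
  set v := S.org (.inr i, false) with hv
  have huniv : (Set.univ : Set K) = insert t {t}ᶜ := by
    ext k; by_cases hk : k = t <;> simp [hk]
  have hz : ∀ z, Joined S.treeOrg {t}ᶜ u z ∨ Joined S.treeOrg {t}ᶜ v z := by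
    intro z
    have h3 := S.conn u z
    rw [huniv] at h3
    rcases h3.of_insert with h3 | ⟨b', -, h4⟩
    · exact Or.inl h3
    · by_cases hb : b' = b
      · subst hb; exact Or.inr (h2.symm.trans h4)
      · have : (!b') = b := by cases b <;> cases b' <;> simp_all
        rw [this] at h4
        exact Or.inl (h1.trans h4)
  have huv : ¬ Joined S.treeOrg {t}ᶜ u v := fun h => by
    refine S.not_forall_joined_compl t fun x y => ?_
    have : ∀ x, Joined S.treeOrg {t}ᶜ u x := fun x => (hz x).elim id h.trans
    exact (this x).symm.trans (this y)
  set σ : V → G := fun z => if Joined S.treeOrg {t}ᶜ u z then 1 else S.gen i with hσ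
  have σor : ∀ z, σ z = 1 ∨ σ z = S.gen i := fun z => by
    by_cases h : Joined S.treeOrg {t}ᶜ u z <;> simp [hσ, h]
  have σu : σ u = 1 := by simp [hσ, Joined.refl]
  have σv : σ v = S.gen i := by simp [hσ, huv]
  have σj : ∀ x y, Joined S.treeOrg {t}ᶜ x y → σ x = σ y := by
    intro x y hxy
    have : Joined S.treeOrg {t}ᶜ u x ↔ Joined S.treeOrg {t}ᶜ u y :=
      ⟨fun h => h.trans hxy, fun h => h.trans hxy.symm⟩
    simp only [hσ, this]
  set τ : K ⊕ ι ≃ K ⊕ ι := Equiv.swap (.inl t) (.inr i) with hτ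
  set L : K ⊕ ι → G := fun e => σ (S.org (τ e, true)) * S.lab (τ e) * (σ (S.org (τ e, false)))⁻¹
    with hL
  have τt : τ (.inl t) = .inr i := by simp [hτ]
  have τi : τ (.inr i) = .inl t := by simp [hτ]
  have τk : ∀ k ≠ t, τ (.inl k) = .inl k := fun k hk =>
    Equiv.swap_apply_of_ne_of_ne (by simpa using hk) (by simp)
  have τj : ∀ j ≠ i, τ (.inr j) = .inr j := fun j hj =>
    Equiv.swap_apply_of_ne_of_ne (by simp) (by simpa using hj)
  have Linl : ∀ k, L (.inl k) = 1 := by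
    intro k
    by_cases hk : k = t
    · subst hk
      simp only [hL, τt, ← hu, ← hv, σu, σv]
      simp [lab]
    · have := σj _ _ (joined_edge (o := S.treeOrg) (A := {t}ᶜ) hk true)
      simp only [Bool.not_true] at this
      simp only [hL, τk k hk, this]
      simp [lab]
  have hni : L (.inr i) = S.gen i ∨ L (.inr i) = (S.gen i)⁻¹ := by
    have s1 := σj _ _ h1
    have s2 := σj _ _ h2
    rw [σu] at s1
    rw [σv] at s2
    simp only [hL, τi]
    cases b
    · simp only [Bool.not_false] at s2
      left; rw [← s1, s2]; simp [lab]
    · simp only [Bool.not_true] at s2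
      right; rw [← s1, s2]; simp [lab]
  have hn : NielsenEquivalent S.gen (fun j => L (.inr j)) :=
    NielsenEquivalent.twist S.gen _ i hni (fun j => σ (S.org (.inr j, true)))
      (fun j => σ (S.org (.inr j, false))) (fun _ => σor _) (fun _ => σor _)
      (fun j hj => by simp only [hL, τj j hj]; rfl)
  set o' : K × Bool → V := fun x => S.org (τ (.inl x.1), x.2) with ho'
  have hlift : ∀ x y, Joined S.treeOrg {t}ᶜ x y → Joined o' Set.univ x y := by
    intro x y hxy
    refine hxy.map id fun k hk => ?_
    have := joined_edge (o := o') (Set.mem_univ k) true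
    simp only [ho', τk k hk, Bool.not_true] at this
    exact this
  have huv' : Joined o' Set.univ u v := by
    have := joined_edge (o := o') (Set.mem_univ t) true
    simpa only [ho', τt, Bool.not_true] using this
  have hbase : ∀ z, Joined o' Set.univ u z := fun z =>
    (hz z).elim (hlift _ _) fun h => huv'.trans (hlift _ _ h)
  refine ⟨⟨fun x => S.org (τ x.1, x.2), fun j => L (.inr j), fun z => σ z • S.pos z,
    S.nielsen.trans hn, fun x y => (hbase x).symm.trans (hbase y), S.card⟩, fun e => ?_⟩
  have hlab : ∀ e, Sum.elim (fun _ => (1 : G)) (fun j => L (.inr j)) e = L e := by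
    rintro (k | j)
    · simp [Linl]
    · rfl
  simp only [len, edgeLength, lab, start, hlab]
  have ττ : τ (τ e) = e := by simp [hτ]
  simp only [hL, ττ]
  rw [mul_smul, mul_smul, inv_smul_smul, dist_smul]
  rfl

end MarkedGraph


/-! ### Nearly shortest graphs with a gap in the edge lengths -/

/-- Among `N + 1` consecutive intervals one contains none of at most `N` numbers. -/
lemma exists_gap {E : Type*} [Fintype E] (len : E → ℝ) {L : ℕ → ℝ} (hL : Monotone L) {N : ℕ}
    (hN : Fintype.card E ≤ N) : ∃ j ≤ N, ∀ e, len e < L j ∨ L (j + 1) ≤ len e := by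
  by_contra! hc
  choose e he using fun j : Fin (N + 1) => hc j (Nat.lt_succ_iff.1 j.2)
  have hne : ∀ i j : Fin (N + 1), i < j → e i ≠ e j := fun i j hij h => by
    have h1 := (he i).2
    have h2 := (he j).1
    have h3 : L (i + 1) ≤ L j := hL (Nat.succ_le_of_lt hij)
    rw [h] at h1
    linarith
  have hinj : Function.Injective e := fun i j h => by
    by_contra hij
    rcases lt_or_gt_of_ne hij with h' | h'
    · exact hne _ _ h' h
    · exact hne _ _ h' h.symm
  have := Fintype.card_le_of_injective e hinj
  simp at this
  omega

lemma Joined.exists_leaving {V K : Type*} {o : K × Bool → V} {A : Set K} {x y : V}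
    (h : Joined o A x y) (hxy : y ≠ x) : ∃ k ∈ A, ∃ b, o (k, b) = x ∧ o (k, !b) ≠ x := by
  induction h with
  | refl => exact absurd rfl hxy
  | @tail z y _ h ih =>
    by_cases hz : z = x
    · obtain ⟨k, hk, b, h1, h2⟩ := h
      exact ⟨k, hk, b, h1.trans hz, h2 ▸ hxy⟩
    · exact ih hz

namespace MarkedGraph

variable {G : Type*} [Group G] {ι : Type*} [DecidableEq ι] [Fintype ι] {g : ι → G}
  {X : Type*} [MetricSpace X] [MulAction G X]

/-- `S` is shortest among all marked graphs for `g`, up to `ε`. -/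
def NearMinimal {V K : Type} [Fintype V] [Fintype K] (S : MarkedGraph g X V K) (ε : ℝ) : Prop :=
  ∀ (V' K' : Type) [Fintype V'] [Fintype K'] (S' : MarkedGraph g X V' K'), S.cost ≤ S'.cost + ε

/-- With more than one vertex, a vertex of degree below 3 could be contracted away. So `3|V| ≤ 2(|K|
+ |ι|)`, and `|V| = |K| + 1` gives the bound. -/
lemma card_le_of_minimal [IsIsometricSMul G X] [Nonempty ι] {V K : Type} [Fintype V] [Fintype K]
    (S : MarkedGraph g X V K) {c : ℝ} (hc : S.cost ≤ c)
    (hmin : ∀ (V' K' : Type) [Fintype V'] [Fintype K'] (S' : MarkedGraph g X V' K'),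
      S'.cost ≤ c → Fintype.card V ≤ Fintype.card V') :
    Fintype.card K ≤ 2 * Fintype.card ι := by
  classical
  by_cases hV : Fintype.card V ≤ 1
  · have := S.card; omega
  have hdeg : ∀ v : V, 3 ≤ (Finset.univ.filter fun h => S.org h = v).card := by
    intro v
    by_contra! h3
    have : Nontrivial V := Fintype.one_lt_card_iff_nontrivial.1 (by omega)
    obtain ⟨y, hy⟩ := exists_ne v
    obtain ⟨k, -, b, h1, h2⟩ := (S.conn v y).exists_leaving hy
    simp only at h1 h2
    have hmem : (Sum.inl k, b) ∈ Finset.univ.filter fun h => S.org h = v := by simp [h1]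
    have h4 : ((Finset.univ.filter fun h => S.org h = v).erase (Sum.inl k, b)).card ≤ 1 := by
      rw [Finset.card_erase_of_mem hmem]; omega
    have : Nonempty ((K ⊕ ι) × Bool) := ⟨(Sum.inl k, b)⟩
    obtain ⟨h, hh⟩ := Finset.card_le_one_iff_subset_singleton.1 h4
    obtain ⟨S', hS'⟩ := S.exists_contract k b (by rw [h1]; exact h2) h (fun h' e => by
      by_cases hk : h' = (Sum.inl k, b)
      · exact Or.inl hk
      · right
        have : h' ∈ (Finset.univ.filter fun h => S.org h = v).erase (Sum.inl k, b) := by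
          simp [hk, e, h1]
        simpa using hh this)
    have h5 := hmin _ _ S' (hS'.trans hc)
    have h6 := Fintype.card_subtype_compl (fun x : V => x = S.org (.inl k, b))
    simp only [Fintype.card_subtype_eq] at h6
    simp only [ne_eq] at h5
    omega
  have hsum := Finset.card_eq_sum_card_fiberwise (s := Finset.univ) (t := Finset.univ)
    (f := S.org) (fun _ _ => Finset.mem_coe.2 (Finset.mem_univ _))
  have h1 : Fintype.card V * 3 ≤ ∑ v, (Finset.univ.filter fun h => S.org h = v).card := by
    rw [← smul_eq_mul, ← Finset.card_univ]
    exact Finset.card_nsmul_le_sum _ _ _ fun v _ => hdeg v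
  rw [← hsum, Finset.card_univ, Fintype.card_prod, Fintype.card_sum, Fintype.card_bool] at h1
  have := S.card
  omega

/-- The wedge of circles. -/
def rose (g : ι → G) (x : X) : MarkedGraph g X Unit Empty where
  org _ := ()
  gen := g
  pos _ := x
  nielsen := Relation.ReflTransGen.refl
  conn _ _ := Joined.refl _
  card := rfl

/-- A nearly shortest marked graph with few edges, a scale at which there is a gap in the lengths
of its edges, and whose tree contains all edges below this scale as far as possible. -/
lemma exists_nearMinimal [IsIsometricSMul G X] [Nonempty ι] [Nonempty X] (g : ι → G) {ε : ℝ}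
    (hε : 0 < ε) {L : ℕ → ℝ} (hL : Monotone L) :
    ∃ (V K : Type) (_ : Fintype V) (_ : Fintype K) (S : MarkedGraph g X V K),
      S.NearMinimal ε ∧ Fintype.card K ≤ 2 * Fintype.card ι ∧ ∃ j ≤ 3 * Fintype.card ι,
        (∀ e, S.len e < L j ∨ L (j + 1) ≤ S.len e) ∧
        ∀ i, S.len (.inr i) < L j → Joined S.treeOrg {k | S.len (.inl k) < L j}
          (S.org (.inr i, true)) (S.org (.inr i, false)) := by
  classical
  obtain ⟨x⟩ := ‹Nonempty X›
  set costs : Set ℝ := {c | ∃ (V K : Type) (_ : Fintype V) (_ : Fintype K)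
    (S : MarkedGraph g X V K), S.cost = c} with hcosts
  have hbdd : BddBelow costs := ⟨0, by rintro _ ⟨V, K, _, _, S, rfl⟩; exact S.cost_nonneg⟩
  have hne : costs.Nonempty := ⟨_, Unit, Empty, inferInstance, inferInstance, rose g x, rfl⟩
  set c := sInf costs + ε with hc
  have hex : ∃ m, ∃ (V K : Type) (_ : Fintype V) (_ : Fintype K) (S : MarkedGraph g X V K),
      S.cost ≤ c ∧ Fintype.card V = m := by
    obtain ⟨_, ⟨V, K, _, _, S, rfl⟩, h⟩ := exists_lt_of_csInf_lt hne
      (show sInf costs < c by linarith)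
    exact ⟨_, V, K, _, _, S, h.le, rfl⟩
  obtain ⟨V, K, _, _, S0, h0, hm⟩ := Nat.find_spec hex
  have hmin : ∀ (V' K' : Type) [Fintype V'] [Fintype K'] (S' : MarkedGraph g X V' K'),
      S'.cost ≤ c → Fintype.card V ≤ Fintype.card V' := fun V' K' _ _ S' h' => by
    rw [hm]; exact Nat.find_min' hex ⟨V', K', _, _, S', h', rfl⟩
  have hK := S0.card_le_of_minimal h0 hmin
  obtain ⟨j, hj, hgap⟩ := exists_gap S0.len hL (N := 3 * Fintype.card ι) (by
    rw [Fintype.card_sum]; omega)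
  -- Exchanges permute edge lengths and thus preserve cost and gap. So the number of short tree
  -- edges can be maximized among graphs with the same `V` and `K`; a short generator edge bypassing
  -- a long tree edge would contradict maximality.
  set good : MarkedGraph g X V K → Prop := fun S =>
    S.cost ≤ c ∧ ∀ e, S.len e < L j ∨ L (j + 1) ≤ S.len e with hgood
  set short : MarkedGraph g X V K → Finset K := fun S =>
    Finset.univ.filter fun k => S.len (.inl k) < L j with hshort
  obtain ⟨S, hS, hmax⟩ := WellFounded.has_min
    (measure fun S : MarkedGraph g X V K => Fintype.card K - (short S).card).wf {S | good S}
    ⟨S0, h0, hgap⟩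
  refine ⟨V, K, _, _, S, ?_, hK, j, hj, hS.2, ?_⟩
  · intro V' K' _ _ S'
    have := csInf_le hbdd ⟨V', K', _, _, S', rfl⟩
    linarith [hS.1]
  · intro i hi
    by_contra hnj
    have hall : Joined S.treeOrg ((Finset.univ : Finset K) : Set K)
        (S.org (.inr i, true)) (S.org (.inr i, false)) := by
      rw [Finset.coe_univ]; exact S.conn _ _
    obtain ⟨t, ht, b, h1, h2⟩ := hall.exists_essential _ hnj
    obtain ⟨S', hS'⟩ := S.exists_exchange i t b h1 h2
    have hcost : S'.cost = S.cost := by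
      change ∑ e, S'.len e = ∑ e, S.len e
      rw [← Equiv.sum_comp (Equiv.swap (.inl t) (.inr i)) S'.len]
      exact Finset.sum_congr rfl fun e _ => hS' e
    have hlen : ∀ e, S'.len e = S.len (Equiv.swap (.inl t) (.inr i) e) := fun e => by
      rw [← hS', Equiv.swap_apply_self]
    have hgood' : good S' := ⟨hcost.trans_le hS.1, fun e => by rw [hlen]; exact hS.2 _⟩
    refine hmax S' hgood' ?_
    change Fintype.card K - (short S').card < Fintype.card K - (short S).card
    have hlt : (short S).card < (short S').card := by
      refine Finset.card_lt_card ?_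
      rw [Finset.ssubset_iff_of_subset]
      · refine ⟨t, ?_, ?_⟩
        · simp [hshort, hlen, hi]
        · simpa [hshort] using ht
      · intro k hk
        have hk' : S.len (.inl k) < L j := by simpa [hshort] using hk
        have hkt : k ≠ t := by rintro rfl; exact ht hk'
        have : S'.len (.inl k) = S.len (.inl k) := by
          rw [hlen, Equiv.swap_apply_of_ne_of_ne (by simpa using hkt) (by simp)]
        simpa [hshort, this] using hk'
    have : (short S').card ≤ Fintype.card K := Finset.card_le_univ _
    omega

end MarkedGraph


/-! ### Divergence of long edges and linear progress along paths -/

lemma gprod_smul {G X : Type*} [Group G] [MetricSpace X] [MulAction G X] [IsIsometricSMul G X]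
    (γ : G) (w x y : X) : gprod (γ • w) (γ • x) (γ • y) = gprod w x y := by
  simp [gprod, dist_smul]

/-- Gromov's four point condition with constant `D`. -/
def FourPoint (X : Type*) [MetricSpace X] (D : ℝ) : Prop :=
  ∀ w x y z : X, min (gprod w x y) (gprod w y z) ≤ gprod w x z + D

namespace MarkedGraph

variable {G : Type*} [Group G] {ι : Type*} [DecidableEq ι] [Fintype ι] {g : ι → G}
  {X : Type*} [MetricSpace X] [MulAction G X] [IsIsometricSMul G X]
  {V K : Type} [Fintype V] [Fintype K]

omit [Fintype ι] in
lemma dist_start_far (S : MarkedGraph g X V K) (h : (K ⊕ ι) × Bool) :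
    dist (S.start h) (S.far h) = S.len h.1 := dist_tip _ _ _

omit [Fintype ι] [MetricSpace X] [IsIsometricSMul G X] in
lemma halfLabel_smul_far_rev (S : MarkedGraph g X V K) (h : (K ⊕ ι) × Bool) :
    halfLabel S.lab h • S.far (rev h) = S.start h := by
  rw [far, tip, halfLabel_rev, smul_inv_smul, rev_rev]

/-- In a nearly shortest graph, long edges leaving a cluster of short edges diverge: otherwise
they could be folded. -/
lemma NearMinimal.gprod_far_le {S : MarkedGraph g X V K} {ε D σ : ℝ} (hS : S.NearMinimal ε)
    (hε : ε < D) (h4 : FourPoint X D) (hX : IsGeodesicSpace X) (hσ0 : 0 ≤ σ) {s : ℝ}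
    {h h' : (K ⊕ ι) × Bool} (hne : h ≠ h') (hh : s ≤ S.len h.1) (hh' : s ≤ S.len h'.1)
    (hL : 3 * σ + 10 * D ≤ S.len h.1) (hε0 : 0 < ε)
    (hj : Joined S.treeOrg {k | S.len (.inl k) < s} (S.org h) (S.org h'))
    (hσ : dist (S.start h) (S.start h') ≤ σ) :
    gprod (S.start h) (S.far h) (S.far h') ≤ σ + 5 * D := by
  classical
  by_contra! hgp
  -- Fold along an initial piece of length `t = σ + 5 * D`. The new edge costs `t`, `h` loses `t`,
  -- and `h'` changes by at most `t + σ - 2 * (t - 2 * D)`; in total at least `D > ε` is saved.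
  obtain ⟨w, hw1, hw2⟩ := hX.exists_between (S.start h) (S.far h) (t := σ + 5 * D) (by linarith)
    (hgp.le.trans (gprod_le_left _ _ _))
  obtain ⟨S', hS'⟩ := S.exists_fold h h' w _ (fun k hk => by
    have hk : S.len (.inl k) < s := hk
    exact ⟨fun e => by rw [e] at hk; linarith, fun e => by rw [e] at hk; linarith⟩) hj
  have hmin := hS _ _ S'
  set u1 := Function.update S.start h w with hu1
  have hu1' : u1 h' = S.start h' := Function.update_of_ne hne.symm _ _
  rw [hS', totalLength_update, totalLength_update, hu1'] at hmin
  change S.cost ≤ dist (S.start h) w + (S.cost - dist (S.start h) (S.far h) + dist w (S.far h) -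
    dist (S.start h') (tip S.lab u1 h') + dist w (tip S.lab u1 h')) + ε at hmin
  rw [hw1, hw2] at hmin
  set q := tip S.lab u1 h' with hq
  have key : σ + 5 * D - 2 * D ≤ gprod (S.start h) w q := by
    have e1 : gprod (S.start h) w (S.far h) = σ + 5 * D := by
      unfold gprod; rw [hw1, hw2]; ring
    have e2 : σ + 5 * D - D ≤ gprod (S.start h) w (S.far h') := by
      have := h4 (S.start h) w (S.far h) (S.far h')
      rw [e1, min_eq_left hgp.le] at this
      linarith
    -- If `h` and `h'` are the two ends of one edge, moving the start of `h` also moves the far end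
    -- of `h'`. The length hypothesis on `h` leaves room for both cuts, and the second costs another
    -- `D`.
    by_cases hr : h' = rev h
    · have hq' : q = halfLabel S.lab h' • w := by
        rw [hq, tip, hr, rev_rev, hu1, Function.update_self]
      have hst : halfLabel S.lab h' • S.far h = S.start h' := by
        rw [← S.halfLabel_smul_far_rev h', hr, rev_rev]
      have hfar : halfLabel S.lab h' • S.start h = S.far h' := by
        rw [far, tip, hr, rev_rev]
      have d1 : dist (S.start h') q = S.len h.1 - (σ + 5 * D) := by
        rw [hq', ← hst, dist_smul, dist_comm, hw2, dist_start_far]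
      have d2 : dist q (S.far h') = σ + 5 * D := by
        rw [hq', ← hfar, dist_smul, dist_comm, hw1]
      have d3 : dist (S.start h') (S.far h') = S.len h.1 := by
        rw [dist_start_far, hr]; rfl
      have e3 : S.len h.1 - (σ + 5 * D) - σ ≤ gprod (S.start h) (S.far h') q := by
        have e4 : gprod (S.start h') (S.far h') q = S.len h.1 - (σ + 5 * D) := by
          unfold gprod; rw [d3, d1, dist_comm, d2]; ring
        have := gprod_le_add_dist (S.start h') (S.start h) (S.far h') q
        rw [dist_comm] at this
        linarith
      have := h4 (S.start h) w (S.far h') q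
      have := le_min e2 (show σ + 5 * D - D ≤ gprod (S.start h) (S.far h') q by linarith)
      linarith
    · have : q = S.far h' := by
        have : rev h' ≠ h := fun e => hr (by rw [← e, rev_rev])
        rw [hq, tip, hu1, Function.update_of_ne this]; rfl
      rw [this]; linarith
  unfold gprod at key
  rw [hw1] at key
  have := dist_triangle (S.start h) (S.start h') q
  linarith

/-- After crossing `m` long edges, the last one being the translate of `h` by `γ`, a path from `x₀`
is far from `x₀` and comes from the direction of the last edge. -/
def Arrives (S : MarkedGraph g X V K) (x₀ : X) (δ R s : ℝ) (m : ℕ) (γ : G)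
    (h : (K ⊕ ι) × Bool) : Prop :=
  δ * m ≤ dist x₀ (γ • S.far h) ∧ R < gprod (γ • S.far h) x₀ (γ • S.start h) ∧ s ≤ S.len h.1

/-- A marked graph in which edges are either short or long, the vertices are grouped in clusters of
diameter at most `σ` by the short edges of the tree, and different long edges diverge when leaving
a cluster. -/
structure Diverging (S : MarkedGraph g X V K) (δ D σ M s : ℝ) : Prop where
  long : ∀ e, S.len e < s ∨ 2 * M + 2 * D + 3 * σ + δ ≤ S.len e
  gen_long : ∀ i, s ≤ S.len (.inr i)
  diam : ∀ x y, Joined S.treeOrg {k | S.len (.inl k) < s} x y → dist (S.pos x) (S.pos y) ≤ σ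
  diverge : ∀ h h', h ≠ h' → s ≤ S.len h.1 → s ≤ S.len h'.1 →
    Joined S.treeOrg {k | S.len (.inl k) < s} (S.org h) (S.org h') →
    gprod (S.start h) (S.far h) (S.far h') ≤ M

variable {S : MarkedGraph g X V K} {δ D σ M s : ℝ} {x₀ : X} {m : ℕ} {γ : G}
  {h h' : (K ⊕ ι) × Bool}

-- At the arrival point the way back to `x₀` agrees with the last edge beyond `M + D`, while the
-- next edge agrees with the last one for at most `M`; so the next edge leaves the way back by `M +
-- D`. Passing to the start of the next edge costs `σ`. The constant in `Diverging.long` is what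
-- makes the distance grow by `δ` and restores the Gromov product bound at the new far end.
omit [Fintype ι] in
lemma Diverging.arrives_step (hS : S.Diverging δ D σ M s) (h4 : FourPoint X D) (hδ : 0 < δ)
    (hσ : 0 ≤ σ)
    (ha : S.Arrives x₀ δ (M + D) s m γ h) (hne : h' ≠ rev h) (hh' : s ≤ S.len h'.1)
    (hj : Joined S.treeOrg {k | S.len (.inl k) < s} (S.org (rev h)) (S.org h')) :
    S.Arrives x₀ δ (M + D) s (m + 1) (γ * halfLabel S.lab h) h' := by
  obtain ⟨h1, h2, h3⟩ := ha
  have hlong : 2 * M + 2 * D + 3 * σ + δ ≤ S.len h'.1 :=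
    (hS.long h'.1).resolve_left (not_lt.2 hh')
  set γ' := γ * halfLabel S.lab h with hγ'
  have e1 : γ • S.far h = γ' • S.start (rev h) := by rw [hγ', mul_smul]; rfl
  have e2 : γ • S.start h = γ' • S.far (rev h) := by
    rw [hγ', mul_smul, halfLabel_smul_far_rev]
  have hd := hS.diverge (rev h) h' hne.symm h3 hh' hj
  rw [← gprod_smul γ', ← e1, ← e2] at hd
  have hσ' : dist (γ • S.far h) (γ' • S.start h') ≤ σ := by
    rw [e1, dist_smul]; exact hS.diam _ _ hj
  have hlen : dist (γ' • S.start h') (γ' • S.far h') = S.len h'.1 := by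
    rw [dist_smul, dist_start_far]
  generalize γ • S.far h = b at *
  generalize γ • S.start h = a at *
  have h5 : gprod b x₀ (γ' • S.far h') ≤ M + D := by
    by_contra! hc
    have := h4 b a x₀ (γ' • S.far h')
    rw [gprod_comm b a x₀] at this
    have := lt_min h2 hc
    linarith
  have h6 := gprod_le_add_dist (γ' • S.start h') b x₀ (γ' • S.far h')
  rw [dist_comm] at h6
  have t1 := dist_triangle x₀ (γ' • S.start h') b
  rw [dist_comm (γ' • S.start h') b] at t1
  have h7 : gprod (γ' • S.start h') x₀ (γ' • S.far h') ≤ M + D + σ := by linarith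
  refine ⟨?_, ?_, hh'⟩
  · push_cast
    unfold gprod at h7
    rw [dist_comm _ x₀, hlen] at h7
    linarith
  · unfold gprod at h7 ⊢
    rw [hlen] at h7
    rw [dist_comm (γ' • S.far h') (γ' • S.start h'), hlen, dist_comm _ x₀]
    rw [dist_comm _ x₀] at h7
    linarith

omit [Fintype ι] [MetricSpace X] [MulAction G X] [IsIsometricSMul G X] in
lemma halfLabel_inl (S : MarkedGraph g X V K) (k : K) (b : Bool) :
    halfLabel S.lab (.inl k, b) = 1 := by
  cases b <;> simp [halfLabel, lab]

omit [Fintype ι] in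
/-- Moving on along edges of the tree without backtracking. -/
lemma Diverging.arrives_tree (hS : S.Diverging δ D σ M s) (h4 : FourPoint X D) (hδ : 0 < δ)
    (hσ : 0 ≤ σ) (A : Finset K) (hA : ∀ k ∈ A, s ≤ S.len (.inl k)) (hhA : ∀ k ∈ A, h.1 ≠ .inl k)
    (ha : S.Arrives x₀ δ (M + D) s m γ h) {y : V}
    (hj : Joined S.treeOrg (A ∪ {k | S.len (.inl k) < s}) (S.org (rev h)) y) :
    ∃ m' ≥ m, ∃ γ' h', S.Arrives x₀ δ (M + D) s m' γ' h' ∧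
      γ' * halfLabel S.lab h' = γ * halfLabel S.lab h ∧
      Joined S.treeOrg {k | S.len (.inl k) < s} (S.org (rev h')) y ∧
      (h' = h ∨ ∃ k ∈ A, h'.1 = .inl k) := by
  classical
  induction A using Finset.induction_on generalizing h γ m y with
  | empty => exact ⟨m, le_rfl, γ, h, ha, rfl, by simpa using hj, Or.inl rfl⟩
  | insert t A ht ih =>
    have ih' := fun {m γ h y} => ih (m := m) (γ := γ) (h := h) (y := y)
      (fun k hk => hA k (Finset.mem_insert_of_mem hk))
    have hA' : ∀ k ∈ A, h.1 ≠ .inl k := fun k hk => hhA k (Finset.mem_insert_of_mem hk)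
    rw [Finset.coe_insert, Set.insert_union] at hj
    rcases hj.of_insert with hj | ⟨b, j1, j2⟩
    · obtain ⟨m', hm, γ', h', r1, r2, r3, r4⟩ := ih' hA' ha hj
      exact ⟨m', hm, γ', h', r1, r2, r3, r4.imp id fun ⟨k, hk, e⟩ =>
        ⟨k, Finset.mem_insert_of_mem hk, e⟩⟩
    · obtain ⟨m1, hm1, γ1, h1, r1, r2, r3, r4⟩ := ih' hA' ha j1
      -- The last long edge crossed is `h` or lies in `A`, and neither can be `t`: this is the
      -- absence of backtracking.
      have hne : (.inl t, b) ≠ rev h1 := by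
        intro e
        have e' : (Sum.inl t : K ⊕ ι) = h1.1 := by rw [← rev_fst h1, ← e]
        rcases r4 with rfl | ⟨k, hk, e4⟩
        · exact hhA t (Finset.mem_insert_self _ _) e'.symm
        · rw [e4] at e'
          cases e'
          exact ht hk
      have st := hS.arrives_step h4 hδ hσ r1 hne (hA t (Finset.mem_insert_self _ _)) r3
      obtain ⟨m2, hm2, γ2, h2, q1, q2, q3, q4⟩ := ih' (fun k hk e => by
        cases e; exact ht hk) st j2
      refine ⟨m2, by omega, γ2, h2, q1, ?_, q3, Or.inr ?_⟩
      · rw [q2, halfLabel_inl, mul_one, r2]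
      · rcases q4 with rfl | ⟨k, hk, e⟩
        · exact ⟨t, Finset.mem_insert_self _ _, rfl⟩
        · exact ⟨k, Finset.mem_insert_of_mem hk, e⟩

-- Between consecutive letters the path runs through the tree, where further long edges only add
-- progress. Thus `m` counts long edges and grows by at least one per letter.
omit [Fintype ι] in
lemma Diverging.arrives_word (hS : S.Diverging δ D σ M s) (h4 : FourPoint X D) (hδ : 0 < δ)
    (hσ : 0 ≤ σ) (w : List (ι × Bool)) (y : ι × Bool) (hw : FreeGroup.IsReduced (y :: w))
    (ha : S.Arrives x₀ δ (M + D) s m γ (.inr y.1, y.2)) :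
    ∃ v, δ * (m + w.length) ≤
      dist x₀ ((γ * FreeGroup.lift S.gen (FreeGroup.mk (y :: w))) • S.pos v) := by
  classical
  induction w generalizing m γ y with
  | nil =>
    refine ⟨S.org (rev (.inr y.1, y.2)), ?_⟩
    have := ha.1
    simp only [List.length_nil, Nat.cast_zero, add_zero]
    convert this using 2
    rw [mul_smul, far, tip]
    congr 2
    rcases y with ⟨i, b⟩
    cases b <;> simp [FreeGroup.lift_mk, halfLabel, lab]
  | cons z w ih =>
    set A : Finset K := Finset.univ.filter fun k => s ≤ S.len (.inl k) with hAdef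
    have huniv : (A : Set K) ∪ {k | S.len (.inl k) < s} = Set.univ := by
      ext k
      simpa [hAdef] using le_or_gt s _
    obtain ⟨m1, hm1, γ1, h1, r1, r2, r3, r4⟩ := hS.arrives_tree h4 hδ hσ A
      (by simp [hAdef]) (by simp) ha (y := S.org (.inr z.1, z.2)) (by rw [huniv]; exact S.conn _ _)
    have hred := List.isChain_cons_cons.1 hw
    -- Either no long tree edge was crossed, and reducedness forbids backtracking, or the last long
    -- edge is a tree edge and differs from the generator edge.
    have hne : (.inr z.1, z.2) ≠ rev h1 := by
      intro e
      rcases r4 with rfl | ⟨k, -, e4⟩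
      · simp only [rev, Prod.mk.injEq, Sum.inr.injEq] at e
        have := hred.1 e.1.symm
        rw [this] at e
        simp at e
      · have : (Sum.inr z.1 : K ⊕ ι) = h1.1 := by rw [← rev_fst h1, ← e]
        rw [e4] at this
        cases this
    have st := hS.arrives_step h4 hδ hσ r1 hne (hS.gen_long _) r3
    obtain ⟨v, hv⟩ := ih z hred.2 st
    refine ⟨v, ?_⟩
    have hg : γ * FreeGroup.lift S.gen (FreeGroup.mk (y :: z :: w)) =
        γ1 * halfLabel S.lab h1 * FreeGroup.lift S.gen (FreeGroup.mk (z :: w)) := by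
      rw [r2, mul_assoc]
      rfl
    rw [hg]
    refine le_trans ?_ hv
    have : (m : ℝ) ≤ m1 := by exact_mod_cast hm1
    simp only [List.length_cons]
    push_cast
    exact mul_le_mul_of_nonneg_left (by linarith) hδ.le

omit [Fintype ι] in
lemma Diverging.exists_norm_le (hS : S.Diverging δ D σ M s) (h4 : FourPoint X D) (hδ : 0 < δ)
    (hD : 0 < D) (hσ : 0 ≤ σ) (hM : 0 ≤ M) (w : FreeGroup ι) :
    ∃ v v', δ * w.norm ≤ dist (S.pos v) (FreeGroup.lift S.gen w • S.pos v') := by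
  have hV : Nonempty V := Fintype.card_pos_iff.1 (by have := S.card; omega)
  have hred : FreeGroup.IsReduced w.toWord := FreeGroup.isReduced_toWord
  obtain ⟨v⟩ := hV
  rcases hw : w.toWord with _ | ⟨y, l⟩
  · refine ⟨v, v, ?_⟩
    simp only [FreeGroup.norm, hw, List.length_nil, Nat.cast_zero, mul_zero]
    exact dist_nonneg
  · rw [hw] at hred
    have hlong : 2 * M + 2 * D + 3 * σ + δ ≤ S.len (.inr y.1) :=
      (hS.long _).resolve_left (not_lt.2 (hS.gen_long _))
    have hd := S.dist_start_far (.inr y.1, y.2)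
    have ha : S.Arrives (S.start (.inr y.1, y.2)) δ (M + D) s 1 1 (.inr y.1, y.2) := by
      refine ⟨?_, ?_, hS.gen_long _⟩
      · rw [one_smul, hd]; push_cast; linarith
      · rw [one_smul, one_smul, gprod, dist_self, dist_comm, hd]
        linarith
    obtain ⟨v', hv'⟩ := hS.arrives_word h4 hδ hσ l y hred ha
    refine ⟨S.org (.inr y.1, y.2), v', ?_⟩
    rw [one_mul, ← hw, FreeGroup.mk_toWord] at hv'
    refine le_trans (le_of_eq ?_) hv'
    simp only [FreeGroup.norm, hw, List.length_cons]
    push_cast; ring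

omit [Fintype ι] in
lemma Diverging.exists_lower_bound (hS : S.Diverging δ D σ M s) (h4 : FourPoint X D) (hδ : 0 < δ)
    (hD : 0 < D) (hσ : 0 ≤ σ) (hM : 0 ≤ M) (x : X) :
    ∃ A, 0 ≤ A ∧ ∀ w : FreeGroup ι, δ * w.norm - A ≤ dist x (FreeGroup.lift S.gen w • x) := by
  have hR : ∀ v, dist x (S.pos v) ≤ ∑ v, dist x (S.pos v) := fun v =>
    Finset.single_le_sum (f := fun v => dist x (S.pos v)) (fun _ _ => dist_nonneg)
      (Finset.mem_univ v)
  refine ⟨2 * ∑ v, dist x (S.pos v), by positivity, fun w => ?_⟩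
  obtain ⟨v, v', h⟩ := hS.exists_norm_le h4 hδ hD hσ hM w
  have t := dist_triangle4 (S.pos v) x (FreeGroup.lift S.gen w • x)
    (FreeGroup.lift S.gen w • S.pos v')
  rw [dist_smul, dist_comm _ x] at t
  linarith [hR v, hR v']

end MarkedGraph


/-! ### From linear displacement to freeness and quasi-isometric embeddings -/

section Free

variable {G : Type*} [Group G] {ι : Type*}

/-- A move comes from an automorphism of the free group. Only its injectivity is needed, and a left
inverse shows it. -/
lemma NielsenMove.exists_injective [DecidableEq ι] {f f' : ι → G} (h : NielsenMove f f') :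
    ∃ β : FreeGroup ι →* FreeGroup ι, Function.Injective β ∧
      FreeGroup.lift f = (FreeGroup.lift f').comp β := by
  have inj : ∀ α β : FreeGroup ι →* FreeGroup ι, α.comp β = MonoidHom.id _ →
      Function.Injective β := fun α β e =>
    Function.LeftInverse.injective (g := α) fun x => DFunLike.congr_fun e x
  cases h with
  | inv i =>
    set β : FreeGroup ι →* FreeGroup ι :=
      FreeGroup.lift (Function.update FreeGroup.of i (FreeGroup.of i)⁻¹) with hβ
    refine ⟨β, inj β β ?_, ?_⟩ <;> ext k <;> by_cases hk : k = i
    · subst hk; simp [hβ]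
    · simp [hβ, hk]
    · subst hk; simp [hβ]
    · simp [hβ, hk]
  | mul i j hij =>
    set β : FreeGroup ι →* FreeGroup ι :=
      FreeGroup.lift (Function.update FreeGroup.of i (FreeGroup.of i * (FreeGroup.of j)⁻¹)) with hβ
    set α : FreeGroup ι →* FreeGroup ι :=
      FreeGroup.lift (Function.update FreeGroup.of i (FreeGroup.of i * FreeGroup.of j)) with hα
    refine ⟨β, inj α β ?_, ?_⟩ <;> ext k <;> by_cases hk : k = i
    · subst hk; simp [hβ, hα, hij.symm]
    · simp [hβ, hα, hk]
    · subst hk; simp [hβ, hij.symm]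
    · simp [hβ, hk]
  | swap i j hij =>
    set β : FreeGroup ι →* FreeGroup ι :=
      FreeGroup.lift (fun k => FreeGroup.of (Equiv.swap i j k)) with hβ
    refine ⟨β, inj β β ?_, ?_⟩ <;> ext k <;> simp [hβ]

lemma NielsenEquivalent.exists_injective [DecidableEq ι] {f f' : ι → G}
    (h : NielsenEquivalent f f') :
    ∃ β : FreeGroup ι →* FreeGroup ι, Function.Injective β ∧
      FreeGroup.lift f = (FreeGroup.lift f').comp β := by
  induction h with
  | refl => exact ⟨MonoidHom.id _, fun _ _ h => h, rfl⟩
  | tail _ h ih =>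
    obtain ⟨β, h1, h2⟩ := ih
    obtain ⟨β', h1', h2'⟩ := h.exists_injective
    exact ⟨β'.comp β, h1'.comp h1, by rw [h2, h2']; rfl⟩

lemma lift_surjective {g : ι → G} (hg : Subgroup.closure (Set.range g) = ⊤) :
    Function.Surjective (FreeGroup.lift g) := by
  rw [← MonoidHom.range_eq_top, FreeGroup.range_lift_eq_closure, hg]

lemma isFreeOn_of_injective {g : ι → G} (hg : Subgroup.closure (Set.range g) = ⊤)
    (hinj : Function.Injective (FreeGroup.lift g)) : IsFreeOn g := by
  refine ⟨.ofRepr (MulEquiv.ofBijective _ ⟨hinj, lift_surjective hg⟩).symm, fun i => ?_⟩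
  exact FreeGroup.lift_apply_of

variable [DecidableEq ι]

lemma wordLength_lift_le (g : ι → G) (w : FreeGroup ι) :
    wordLength g (FreeGroup.lift g w) ≤ w.norm :=
  Nat.sInf_le ⟨w.toWord, by rw [FreeGroup.mk_toWord], rfl⟩

lemma exists_wordLength_eq {g : ι → G} (hg : Subgroup.closure (Set.range g) = ⊤) (h : G) :
    ∃ w : List (ι × Bool), FreeGroup.lift g (FreeGroup.mk w) = h ∧ w.length = wordLength g h := by
  refine Nat.sInf_mem (s := {k : ℕ | ∃ w : List (ι × Bool),
    FreeGroup.lift g (FreeGroup.mk w) = h ∧ w.length = k}) ?_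
  obtain ⟨w, rfl⟩ := lift_surjective hg h
  exact ⟨_, w.toWord, by rw [FreeGroup.mk_toWord], rfl⟩

lemma mk_cons_eq_mul {α : Type*} (y : α × Bool) (l : List (α × Bool)) :
    FreeGroup.mk (y :: l) = FreeGroup.mk [y] * FreeGroup.mk l := rfl

lemma exists_norm_lift_le [Fintype ι] (u : ι → FreeGroup ι) (l : List (ι × Bool)) :
    (FreeGroup.lift u (FreeGroup.mk l)).norm ≤ (∑ i, (u i).norm) * l.length := by
  induction l with
  | nil => simp [← FreeGroup.one_eq_mk]
  | cons y l ih =>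
    rw [mk_cons_eq_mul, map_mul, List.length_cons, mul_add, mul_one, add_comm]
    refine (FreeGroup.norm_mul_le _ _).trans (add_le_add ?_ ih)
    have h1 : (u y.1).norm ≤ ∑ i, (u i).norm :=
      Finset.single_le_sum (f := fun i => (u i).norm) (fun _ _ => Nat.zero_le _)
        (Finset.mem_univ y.1)
    rcases y with ⟨i, b⟩
    cases b <;> simpa [FreeGroup.lift_mk] using h1

/-- The kernel lies in a finite ball, whereas a nontrivial element of a free group has infinitely
many powers. -/
lemma injective_of_norm_le [Finite ι] (φ : FreeGroup ι →* G) (N : ℕ)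
    (h : ∀ w, φ w = 1 → w.norm ≤ N) : Function.Injective φ := by
  rw [injective_iff_map_eq_one]
  intro w hw
  by_contra hne
  have hfin : {w : FreeGroup ι | w.norm ≤ N}.Finite :=
    (List.finite_length_le (ι × Bool) N).preimage FreeGroup.toWord_injective.injOn
  have hinj : Function.Injective fun k : ℕ => w ^ k := by
    rw [injective_pow_iff_not_isOfFinOrder]
    exact not_isOfFinOrder_of_isMulTorsionFree hne
  refine Set.infinite_range_of_injective hinj (hfin.subset ?_)
  rintro _ ⟨k, rfl⟩
  exact h _ (by rw [map_pow, hw, one_pow])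

variable [Fintype ι] {X : Type*} [MetricSpace X] [MulAction G X] [IsIsometricSMul G X]

omit [DecidableEq ι] in
lemma dist_lift_smul_le (g : ι → G) (x : X) (l : List (ι × Bool)) :
    dist x (FreeGroup.lift g (FreeGroup.mk l) • x) ≤ (∑ i, dist x (g i • x)) * l.length := by
  induction l with
  | nil => simp [← FreeGroup.one_eq_mk]
  | cons y l ih =>
    rw [mk_cons_eq_mul, map_mul, List.length_cons, mul_smul]
    set a := FreeGroup.lift g (FreeGroup.mk [y]) with ha
    have h1 : dist x (a • x) ≤ ∑ i, dist x (g i • x) := by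
      refine le_trans (le_of_eq ?_) (Finset.single_le_sum (f := fun i => dist x (g i • x))
        (fun _ _ => dist_nonneg) (Finset.mem_univ y.1))
      rcases y with ⟨i, b⟩
      cases b
      · simp only [ha, FreeGroup.lift_mk, List.map_cons, List.map_nil, cond_false,
          List.prod_singleton]
        rw [← dist_smul (g i), smul_inv_smul, dist_comm]
      · simp [ha, FreeGroup.lift_mk]
    have h2 := dist_triangle x (a • x) (a • FreeGroup.lift g (FreeGroup.mk l) • x)
    rw [dist_smul] at h2
    push_cast
    linarith

/-- A linear lower bound on the displacement in terms of the word length for a Nielsen equivalent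
tuple makes a group free and its orbit maps quasi-isometric embeddings. -/
lemma free_and_quasiIsometric {g f : ι → G} (hg : Subgroup.closure (Set.range g) = ⊤)
    (hf : NielsenEquivalent g f) {δ : ℝ} (hδ : 0 < δ) [Nonempty X]
    (hlow : ∀ x : X, ∃ A, 0 ≤ A ∧
      ∀ w : FreeGroup ι, δ * w.norm - A ≤ dist x (FreeGroup.lift f w • x)) :
    IsFreeOn g ∧ ∀ x : X, IsQuasiIsometricEmbedding (wordDist g) (fun h : G => h • x) := by
  obtain ⟨β, hβ, hgf⟩ := hf.exists_injective
  have hfinj : Function.Injective (FreeGroup.lift f) := by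
    obtain ⟨x⟩ := ‹Nonempty X›
    obtain ⟨A, hA, h⟩ := hlow x
    refine injective_of_norm_le _ ⌈A / δ⌉₊ fun w hw => ?_
    have := h w
    rw [hw, one_smul, dist_self] at this
    have h1 : (w.norm : ℝ) ≤ A / δ := by
      rw [le_div_iff₀ hδ]; linarith
    exact_mod_cast h1.trans (Nat.le_ceil _)
  refine ⟨isFreeOn_of_injective hg (by rw [hgf]; exact hfinj.comp hβ), fun x => ?_⟩
  obtain ⟨A, hA, h⟩ := hlow x
  -- Writing the entries of `f` as words in `g` compares the norm for `f` with the word length for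
  -- `g`, up to the factor `C`.
  choose u hu using fun i => lift_surjective hg (f i)
  set C : ℕ := ∑ i, (u i).norm with hC
  have hcomp : FreeGroup.lift f = (FreeGroup.lift g).comp (FreeGroup.lift u) := by
    ext i; simp [hu]
  have hword : ∀ w : FreeGroup ι, wordLength g (FreeGroup.lift f w) ≤ C * w.norm := by
    intro w
    rw [hcomp]
    refine (wordLength_lift_le g _).trans ?_
    have := exists_norm_lift_le u w.toWord
    rwa [FreeGroup.mk_toWord] at this
  set B := ∑ i, dist x (g i • x) with hB
  have hB0 : 0 ≤ B := Finset.sum_nonneg fun _ _ => dist_nonneg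
  have hlo : ∀ h : G, δ * wordLength g h ≤ C * (dist x (h • x) + A) := by
    intro k
    obtain ⟨w, hw⟩ := lift_surjective hg k
    rw [hgf] at hw
    have h1 := h (β w)
    have h2 := hword (β w)
    rw [MonoidHom.comp_apply] at hw
    rw [hw] at h1 h2
    have h2' : (wordLength g k : ℝ) ≤ C * (β w).norm := by exact_mod_cast h2
    have h3 := mul_le_mul_of_nonneg_left h2' hδ.le
    have h4 := mul_le_mul_of_nonneg_left (show δ * (β w).norm ≤ dist x (k • x) + A by linarith)
      (Nat.cast_nonneg (α := ℝ) C)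
    linarith
  have hup : ∀ h : G, dist x (h • x) ≤ B * wordLength g h := by
    intro k
    obtain ⟨l, hl, hlen⟩ := exists_wordLength_eq hg k
    have := dist_lift_smul_le g x l
    rwa [hl, hlen] at this
  have hcd : 0 ≤ (C : ℝ) / δ := by positivity
  -- `C / δ` serves the lower bound, `B` the upper bound, and `1` makes the factor at least one.
  refine ⟨1 + C / δ + B, by linarith, A, hA, fun a b => ?_⟩
  have hab : dist (a • x) (b • x) = dist x ((a⁻¹ * b) • x) := by
    rw [mul_smul, ← dist_smul a⁻¹, inv_smul_smul]
  simp only [wordDist]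
  rw [hab]
  have h1 := hlo (a⁻¹ * b)
  have h2 := hup (a⁻¹ * b)
  have hW : (0 : ℝ) ≤ wordLength g (a⁻¹ * b) := Nat.cast_nonneg _
  have hd : 0 ≤ dist x ((a⁻¹ * b) • x) := dist_nonneg
  generalize dist x ((a⁻¹ * b) • x) = d at *
  generalize (wordLength g (a⁻¹ * b) : ℝ) = W at *
  constructor
  · have h3 : W ≤ C / δ * (d + A) := by
      rw [div_mul_eq_mul_div, le_div_iff₀ hδ]; linarith
    have h4 : W ≤ (1 + C / δ + B) * (d + A) := by
      refine h3.trans (mul_le_mul_of_nonneg_right ?_ (by linarith))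
      linarith
    have : (1 + C / δ + B)⁻¹ * W ≤ d + A := by
      rw [inv_mul_le_iff₀ (by linarith)]; exact h4
    linarith
  · have : B * W ≤ (1 + C / δ + B) * W := mul_le_mul_of_nonneg_right (by linarith) hW
    linarith

end Free

/-! ### Choice of constants and conclusion -/

/-- The growing sequence of scales used to separate short from long edges. -/
def scale (a : ℝ) : ℕ → ℝ
  | 0 => 0
  | j + 1 => 5 * a * scale a j + 61

lemma scale_nonneg {a : ℝ} (ha : 0 ≤ a) (j : ℕ) : 0 ≤ scale a j := by
  induction j with
  | zero => exact le_rfl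
  | succ j ih => rw [scale]; positivity

lemma scale_monotone {a : ℝ} (ha : 1 ≤ a) : Monotone (scale a) := by
  refine monotone_nat_of_le_succ fun j => ?_
  have := scale_nonneg (zero_le_one.trans ha) j
  rw [scale]
  nlinarith

end NielsenHyp

theorem theorem1 (n : ℕ) (hn : 0 < n) :
    ∃ C : ℝ, 0 < C ∧
      ∀ (G : Type*) [Group G] (X : Type*) [MetricSpace X] [Nonempty X]
        [MulAction G X] [IsIsometricSMul G X] (δ : ℝ) (g : Fin n → G),
        0 < δ →
        NielsenHyp.IsHyperbolicGeodesicSpace X δ →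
        Subgroup.closure (Set.range g) = ⊤ →
        (NielsenHyp.IsFreeOn g ∧
            ∀ x : X, NielsenHyp.IsQuasiIsometricEmbedding (NielsenHyp.wordDist g)
              (fun h : G => h • x)) ∨
          (∃ f : Fin n → G, NielsenHyp.NielsenEquivalent g f ∧
            ∃ y : X, dist (f ⟨0, hn⟩ • y) y < δ * C) := by
  open NielsenHyp MarkedGraph in
  set a : ℝ := 2 ^ (2 * n) with ha
  have ha1 : 1 ≤ a := one_le_pow₀ (by norm_num)
  have hs0 := scale_nonneg (zero_le_one.trans ha1)
  -- A short generator edge has length below `s`, and the way back through its cluster is at most `a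
  -- * s`, where `s ≤ δ * scale a (3 * n)`. The final `1` makes positivity immediate.
  refine ⟨(a + 1) * scale a (3 * n) + 1, by have := hs0 (3 * n); positivity, ?_⟩
  intro G _ X _ _ _ _ δ g hδ hX hg
  have : Nonempty (Fin n) := ⟨⟨0, hn⟩⟩
  obtain ⟨V, K, _, _, S, hmin, hK, j, hj, hgap, hshort⟩ := exists_nearMinimal (X := X) g hδ
    (L := fun j => δ * scale a j) (fun i j hij => mul_le_mul_of_nonneg_left
      (scale_monotone ha1 hij) hδ.le)
  rw [Fintype.card_fin] at hK hj
  set s := δ * scale a j with hs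
  have hspos : 0 ≤ s := mul_nonneg hδ.le (hs0 j)
  have hdiam : ∀ x y, Joined S.treeOrg {k | S.len (.inl k) < s} x y →
      dist (S.pos x) (S.pos y) ≤ a * s := by
    classical
    intro x y hxy
    have h1 : ((Finset.univ.filter fun k => S.len (.inl k) < s : Finset K) : Set K) =
        {k | S.len (.inl k) < s} := by simp
    rw [← h1] at hxy
    have h2 := hxy.dist_le S.pos hspos _ (fun k hk => by
      have hk' : S.len (.inl k) < s := by simpa using hk
      have : S.len (.inl k) = dist (S.pos (S.org (.inl k, true))) (S.pos (S.org (.inl k, false))) :=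
        by simp [len, edgeLength, lab, start]
      linarith)
    refine h2.trans (mul_le_mul_of_nonneg_right ?_ hspos)
    have h3 : (2 : ℝ) ^ (Finset.univ.filter fun k => S.len (.inl k) < s).card ≤ a :=
      pow_le_pow_right₀ (by norm_num) ((Finset.card_le_univ _).trans hK)
    linarith
  by_cases hgen : ∃ i, S.len (.inr i) < s
  · right
    obtain ⟨i, hi⟩ := hgen
    have h1 := hdiam _ _ (hshort i hi)
    have h2 : S.len (.inr i) = dist (S.pos (S.org (.inr i, true)))
      (S.gen i • S.pos (S.org (.inr i, false))) := rfl
    have hlt : dist (S.gen i • S.pos (S.org (.inr i, false))) (S.pos (S.org (.inr i, false))) <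
        δ * ((a + 1) * scale a (3 * n) + 1) := by
      have t := dist_triangle_left (S.gen i • S.pos (S.org (.inr i, false)))
        (S.pos (S.org (.inr i, false))) (S.pos (S.org (.inr i, true)))
      have h3 : s ≤ δ * scale a (3 * n) :=
        mul_le_mul_of_nonneg_left (scale_monotone ha1 hj) hδ.le
      have h4 := mul_le_mul_of_nonneg_left h3 (show 0 ≤ a + 1 by linarith)
      linarith
    by_cases hi0 : i = ⟨0, hn⟩
    · subst hi0
      exact ⟨S.gen, S.nielsen, _, hlt⟩
    · refine ⟨S.gen ∘ Equiv.swap i ⟨0, hn⟩,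
        S.nielsen.trans (Relation.ReflTransGen.single (.swap _ _ _ hi0)),
        S.pos (S.org (.inr i, false)), ?_⟩
      simpa using hlt
  · left
    push Not at hgen
    have h4 : FourPoint X (5 * δ) := four_point hδ hX
    have hσ : 0 ≤ a * s := by positivity
    -- The recursion for `scale` is made for this: with `D = 5δ`, `σ = a * s` and `M = σ + 5D`, the
    -- required length `2M + 2D + 3σ + δ` equals `5σ + 61δ`, which is `δ` times the next scale.
    have hlong : ∀ e, s ≤ S.len e → 5 * (a * s) + 61 * δ ≤ S.len e := fun e he => by
      have h5 := (hgap e).resolve_left (not_lt.2 he)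
      rw [scale] at h5
      have : δ * (5 * a * scale a j + 61) = 5 * (a * s) + 61 * δ := by rw [hs]; ring
      linarith
    have hdiv : S.Diverging δ (5 * δ) (a * s) (a * s + 5 * (5 * δ)) s :=
      { long := fun e => (lt_or_ge (S.len e) s).imp id fun he => by linarith [hlong e he]
        gen_long := hgen
        diam := hdiam
        diverge := fun h h' hne hh hh' hj => hmin.gprod_far_le (by linarith) h4 hX.1 hσ hne hh hh'
          (by linarith [hlong _ hh]) hδ hj (hdiam _ _ hj) }
    exact free_and_quasiIsometric hg S.nielsen hδ fun x =>
      hdiv.exists_lower_bound h4 hδ (by linarith) hσ (by linarith) x
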